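/- \textbf{Setting.} Let $\mathcal S_\Theta\subset\mathbb R^P$ be finite and $\mathsf X\subset\mathbb R^n$ compact. Let $\hat\beta=\sum_{i=1}^N\omega_i\,\delta_{(\theta_i,x_i)}$ be a particle belief: $(\theta_i,x_i)\in\mathcal S_\Theta\times\mathsf X$, $\omega_i\ge 0$, $\sum_i\omega_i=1$. For $\theta\in\mathcal S_\Theta$ put $\mathcal I_\theta=\{i:\theta_i=\theta\}$ and $\hat q(\theta)=\sum_{i\in\mathcal I_\theta}\omega_i$. A policy kernel with densities $k(\cdot\mid\theta,x)$ on $\mathbb R^d$, $(\theta,x)\in\mathcal S_\Theta\times\mathsf X$, induces the densities $p(y)=\sum_i\omega_i k(y\mid\theta_i,x_i)$ of $Y$ and $p(y\mid\theta)=\sum_{i\in\mathcal I_\theta}\frac{\omega_i}{\hat q(\theta)}k(y\mid\theta,x_i)$ of $Y$ given $\Theta=\theta$ (if $\hat q(\theta)>0$), and, with $H(f)=-\int f\log f$, the particle mutual information $$I(k)=H\big(p(\cdot)\big)-\sum_{\theta\in\mathcal S_\Theta}\hat q(\theta)\,H\big(p(\cdot\mid\theta)\big).$$ A finite Gaussian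 mixture policy kernel $\hat{\mathcal K}$ with $J$ components has densities $\hat k(y\mid\theta,x)=\sum_{j=1}^J a_j(\theta,x)\,\mathcal N(y;\mu_j(\theta,x),\Sigma_j(\theta,x))$ with $a_j\ge0$, $\sum_ja_j=1$, $\Sigma_j$ positive definite, and $a_j,\mu_j,\Sigma_j$ measurable in $x$. \textbf{Regime-adaptive bound.} For such a kernel, index the Gaussians $\mathcal N_{(i,j)}=\mathcal N(\mu_j(\theta_i,x_i),\Sigma_j(\theta_i,x_i))$ by pairs $r=(i,j)$ and put $w_{(i,j)}=\omega_i a_j(\theta_i,x_i)$ and, for $i\in\mathcal I_\theta$, $\bar w_{(i,j)}(\theta)=w_{(i,j)}/\hat q(\theta)$. For $\alpha\in[0,1]$ let $$\widehat I_{\mathrm{RA},\alpha}(\hat{\mathcal K})=\min\{\widehat H_{\mathrm{KL}},\widehat H_{\mathrm G}\}-\sum_{\theta\in\mathcal S_\Theta}\hat q(\theta)\,\widehat H_{C_\alpha}(\theta),$$ $$\widehat H_{\mathrm{KL}}=\sum_r w_rH(\mathcal N_r)-\sum_r w_r\log\sum_s w_s e^{-\mathrm{KL}(\mathcal N_r\|\mathcal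 N_s)},\qquad \widehat H_{\mathrm G}=\tfrac12\log\big((2\pi e)^d\det\Sigma_{\mathrm{glob}}\big),$$ $$\widehat H_{C_\alpha}(\theta)=\sum_r\bar w_r(\theta)H(\mathcal N_r)-\sum_r\bar w_r(\theta)\log\sum_s\bar w_s(\theta)e^{-C_\alpha(\mathcal N_r\|\mathcal N_s)},$$ where the sums in $\widehat H_{C_\alpha}(\theta)$ run over pairs with first entry in $\mathcal I_\theta$, $\Sigma_{\mathrm{glob}}$ is the covariance matrix $\sum_r w_r\big(\Sigma_r+(\mu_r-\bar\mu)(\mu_r-\bar\mu)^\top\big)$, $\bar\mu=\sum_rw_r\mu_r$, of the mixture $\sum_r w_r\mathcal N_r$, and $\mathrm{KL}(p\|q)=\int p\log\frac pq$, $C_\alpha(p\|q)=-\log\int p^\alpha q^{1-\alpha}$. \textbf{Statement.} Let $k(\cdot\mid\theta,x)$ be a continuous policy kernel density: for all $(\theta,x)\in\mathcal S_\Theta\times\mathsf X$ a (measurable) probability density on $\mathbb R^d$, with $x\mapsto k(y\mid\theta,x)$ continuous for all $(\theta,y)$. Assume that $H(p(\cdot))$ and $H(p(\cdot\mid\theta))$,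 for every $\theta$ with $\hat q(\theta)>0$, are finite. Then for all $\varepsilon>0$ and $\delta>0$ there is a finite Gaussian mixture policy kernel $\hat{\mathcal K}_{J}$, $J=J(\delta)$ (which may also depend on $\varepsilon$), with densities $\hat k$, such that the analogous entropies for $\hat k$ are finite, $$\sup_{(\theta,x)\in\mathcal S_\Theta\times\mathsf X}\big\|k(\cdot\mid\theta,x)-\hat k(\cdot\mid\theta,x)\big\|_{L^1}\le\delta,\qquad \big|I(k)-I(\hat k)\big|\le\varepsilon,$$ and, for every $\alpha\in[0,1]$, $$I(k)\le\widehat I_{\mathrm{RA},\alpha}(\hat{\mathcal K}_{J})+\varepsilon.$$ The right-hand side is computable: $\widehat I_{\mathrm{RA},\alpha}(\hat{\mathcal K}_J)$ equals the closed-form expression in the weights, means and covariances obtained by inserting, for $g=\mathcal N(\mu,\Sigma)$, $g'=\mathcal N(\mu',\Sigma')$ and $M=(1-\alpha)\Sigma+\alpha\Sigma'$, $$H(g)=\tfrac12\log\big((2\pi e)^d\det\Sigma\big),\quad \mathrm{KL}(g\|g')=\tfrac12\Big(\operatorname{tr}(\Sigma'^{-1}\Sigma)-d+(\mu'-\mu)^\top\Sigma'^{-1}(\mu'-\mu)+\log\tfrac{\det\Sigma'}{\det\Sigma}\Big),$$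 $$C_\alpha(g\|g')=\tfrac{\alpha(1-\alpha)}2(\mu'-\mu)^\top M^{-1}(\mu'-\mu)+\tfrac12\log\frac{\det M}{(\det\Sigma)^{1-\alpha}(\det\Sigma')^{\alpha}}.$$ -/

import Mathlib

open MeasureTheory

noncomputable section

namespace ParticleMI

/-- `ℝ^d` with its Euclidean norm and Lebesgue measure. -/
abbrev E (d : ℕ) : Type := EuclideanSpace ℝ (Fin d)

/-! ### Differential entropy and divergences of densities on `ℝ^d` -/

/-- The differential entropy `H(f) = -∫ f log f`. -/
def diffEntropy {d : ℕ} (f : E d → ℝ) : ℝ := -∫ y, f y * Real.log (f y)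

/-- The differential entropy of `f` exists and is finite. -/
def HasFiniteEntropy {d : ℕ} (f : E d → ℝ) : Prop :=
  Integrable fun y => f y * Real.log (f y)

/-- The Kullback-Leibler divergence `KL(p ‖ q) = ∫ p log (p / q)`. -/
def klDivergence {d : ℕ} (p q : E d → ℝ) : ℝ := ∫ y, p y * Real.log (p y / q y)

/-- The Chernoff `α`-divergence `C_α(p ‖ q) = -log ∫ p^α q^(1-α)`. -/
def chernoffDivergence {d : ℕ} (α : ℝ) (p q : E d → ℝ) : ℝ :=
  -Real.log (∫ y, p y ^ α * q y ^ (1 - α))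

/-! ### Gaussian components -/

/-- The parameters of a nondegenerate Gaussian distribution on `ℝ^d`. -/
structure Gaussian (d : ℕ) where
  mean : E d
  cov : Matrix (Fin d) (Fin d) ℝ
  posDef : cov.PosDef

namespace Gaussian

variable {d : ℕ}

/-- The quadratic form `vᵀ A v`. -/
def quad (A : Matrix (Fin d) (Fin d) ℝ) (v : E d) : ℝ :=
  dotProduct v.ofLp (A.mulVec v.ofLp)

/-- The density `𝒩(y; μ, Σ) = ((2π)^d |Σ|)^(-1/2) exp(-(y-μ)ᵀ Σ⁻¹ (y-μ) / 2)`. -/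
def pdf (g : Gaussian d) (y : E d) : ℝ :=
  (Real.sqrt ((2 * Real.pi) ^ d * g.cov.det))⁻¹ *
    Real.exp (-(quad g.cov⁻¹ (y - g.mean)) / 2)

/-- Closed form of the entropy of a Gaussian: `½ log ((2πe)^d |Σ|)`. -/
def entropyFormula (g : Gaussian d) : ℝ :=
  1 / 2 * Real.log ((2 * Real.pi * Real.exp 1) ^ d * g.cov.det)

/-- Closed form of the Kullback-Leibler divergence of two Gaussians. -/
def klFormula (g g' : Gaussian d) : ℝ :=
  1 / 2 * ((g'.cov⁻¹ * g.cov).trace - d + quad g'.cov⁻¹ (g'.mean - g.mean)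
    + Real.log (g'.cov.det / g.cov.det))

/-- Closed form of the Chernoff `α`-divergence of two Gaussians, with
`M = (1-α) Σ + α Σ'`. -/
def chernoffFormula (α : ℝ) (g g' : Gaussian d) : ℝ :=
  α * (1 - α) / 2 * quad ((1 - α) • g.cov + α • g'.cov)⁻¹ (g'.mean - g.mean)
    + 1 / 2 * Real.log (((1 - α) • g.cov + α • g'.cov).det /
        (g.cov.det ^ (1 - α) * g'.cov.det ^ α))

end Gaussian

/-! ### Particle beliefs and the mutual information they induce -/

/-- A particle belief `∑ i, ω i • δ_(θ i, x i)` with `N` particles in `Θ × X`. -/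
structure ParticleBelief (Θ X : Type*) (N : ℕ) where
  θ : Fin N → Θ
  x : Fin N → X
  ω : Fin N → ℝ
  ω_nonneg : ∀ i, 0 ≤ ω i
  ω_sum : ∑ i, ω i = 1

namespace ParticleBelief

variable {Θ X : Type*} {N d : ℕ}

open Classical in
/-- The set `ℐ_θ` of the particles with parameter `θ`. -/
def idx (b : ParticleBelief Θ X N) (t : Θ) : Finset (Fin N) :=
  Finset.univ.filter fun i => b.θ i = t

/-- The marginal mass `q̂(θ)`. -/
def q (b : ParticleBelief Θ X N) (t : Θ) : ℝ := ∑ i ∈ b.idx t, b.ω i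

/-- The density of `Y` when `Y` given `(θ, x)` has density `k θ x` and `(θ, x)` is
distributed according to the particle belief. -/
def marginal (b : ParticleBelief Θ X N) (k : Θ → X → E d → ℝ) (y : E d) : ℝ :=
  ∑ i, b.ω i * k (b.θ i) (b.x i) y

/-- The conditional density of `Y` given `Θ = θ` (zero if `q̂(θ) = 0`). -/
def conditional (b : ParticleBelief Θ X N) (k : Θ → X → E d → ℝ) (t : Θ) (y : E d) : ℝ :=
  ∑ i ∈ b.idx t, b.ω i / b.q t * k t (b.x i) y

/-- The entropies `H(Y)` and `H(Y ∣ Θ = θ)`, for every `θ` of positive mass, are finite. -/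
def FiniteEntropies (b : ParticleBelief Θ X N) (k : Θ → X → E d → ℝ) : Prop :=
  HasFiniteEntropy (b.marginal k) ∧ ∀ t, 0 < b.q t → HasFiniteEntropy (b.conditional k t)

/-- The particle mutual information `I(Θ; Y) = H(Y) - H(Y ∣ Θ)`. -/
def mutualInfo [Fintype Θ] (b : ParticleBelief Θ X N) (k : Θ → X → E d → ℝ) : ℝ :=
  diffEntropy (b.marginal k) - ∑ t, b.q t * diffEntropy (b.conditional k t)

end ParticleBelief

/-! ### Policy kernels -/

/-- `k θ x` is a probability density on `ℝ^d` for all `(θ, x)`, and depends continuously on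
the state `x`. -/
structure IsContinuousPolicy {Θ X : Type*} [TopologicalSpace X] {d : ℕ}
    (k : Θ → X → E d → ℝ) : Prop where
  measurable : ∀ t x, Measurable (k t x)
  nonneg : ∀ t x y, 0 ≤ k t x y
  integral_eq_one : ∀ t x, ∫ y, k t x y = 1
  continuous_state : ∀ t y, Continuous fun x => k t x y

/-- A policy kernel that is a finite Gaussian mixture: for all `(θ, x)` a mixture of `J`
Gaussians, whose weights, means and covariances depend measurably on the state. -/
structure GMMPolicy (Θ X : Type*) [MeasurableSpace X] (d J : ℕ) where
  weight : Θ → X → Fin J → ℝ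
  comp : Θ → X → Fin J → Gaussian d
  weight_nonneg : ∀ t x j, 0 ≤ weight t x j
  weight_sum : ∀ t x, ∑ j, weight t x j = 1
  measurable_weight : ∀ t j, Measurable fun x => weight t x j
  measurable_mean : ∀ t j, Measurable fun x => (comp t x j).mean
  measurable_cov : ∀ t j a c, Measurable fun x => (comp t x j).cov a c

/-! ### The regime-adaptive bound -/

/-- `∑ i, w i h i - ∑ i, w i log (∑ j, w j exp (-D i j))`: the estimate of the entropy of the
mixture with components `i ∈ s`, weights `w`, component entropies `h`, obtained from the
pairwise divergences `D`. -/
def pairwiseEntropy {ι : Type*} (s : Finset ι) (w h : ι → ℝ) (D : ι → ι → ℝ) : ℝ :=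
  ∑ i ∈ s, w i * h i - ∑ i ∈ s, w i * Real.log (∑ j ∈ s, w j * Real.exp (-(D i j)))

/-- The covariance matrix of the mixture of the Gaussians `g i` with weights `w i`. -/
def mixtureCov {ι : Type*} [Fintype ι] {d : ℕ} (w : ι → ℝ) (g : ι → Gaussian d) :
    Matrix (Fin d) (Fin d) ℝ :=
  let m : E d := ∑ i, w i • (g i).mean
  ∑ i, w i • ((g i).cov +
    Matrix.vecMulVec ((g i).mean - m).ofLp ((g i).mean - m).ofLp)

/-- The maximum-entropy bound `½ log ((2πe)^d |Σ_glob|)`. -/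
def maxEntropyBound {ι : Type*} [Fintype ι] {d : ℕ} (w : ι → ℝ) (g : ι → Gaussian d) : ℝ :=
  1 / 2 * Real.log ((2 * Real.pi * Real.exp 1) ^ d * (mixtureCov w g).det)

namespace GMMPolicy

variable {Θ X : Type*} [MeasurableSpace X] {N d J : ℕ}

/-- The conditional density of the mixture policy. -/
def density (K : GMMPolicy Θ X d J) (t : Θ) (x : X) (y : E d) : ℝ :=
  ∑ j, K.weight t x j * (K.comp t x j).pdf y

/-- The Gaussian component `j` of particle `i`. -/
def particleComp (K : GMMPolicy Θ X d J) (b : ParticleBelief Θ X N) (p : Fin N × Fin J) :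
    Gaussian d :=
  K.comp (b.θ p.1) (b.x p.1) p.2

/-- The weight of component `j` of particle `i` in the mixture density of `Y`. -/
def particleWeight (K : GMMPolicy Θ X d J) (b : ParticleBelief Θ X N) (p : Fin N × Fin J) : ℝ :=
  b.ω p.1 * K.weight (b.θ p.1) (b.x p.1) p.2

/-- The weight of component `j` of particle `i` in the mixture density of `Y` given `θ`. -/
def condWeight (K : GMMPolicy Θ X d J) (b : ParticleBelief Θ X N) (t : Θ)
    (p : Fin N × Fin J) : ℝ :=
  b.ω p.1 / b.q t * K.weight (b.θ p.1) (b.x p.1) p.2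

/-- `min {Ĥ_KL, Ĥ_G} - ∑ θ, q̂(θ) Ĥ_C(θ)`, computed from an expression `H` for the entropies
of the Gaussian components and expressions `KL` and `C` for their pairwise divergences. -/
def raBoundWith [Fintype Θ] (K : GMMPolicy Θ X d J) (b : ParticleBelief Θ X N)
    (H : Gaussian d → ℝ) (KL C : Gaussian d → Gaussian d → ℝ) : ℝ :=
  min
    (pairwiseEntropy Finset.univ (K.particleWeight b) (fun p => H (K.particleComp b p))
      fun p r => KL (K.particleComp b p) (K.particleComp b r))
    (maxEntropyBound (K.particleWeight b) (K.particleComp b))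
  - ∑ t, b.q t *
      pairwiseEntropy (b.idx t ×ˢ Finset.univ) (K.condWeight b t)
        (fun p => H (K.particleComp b p))
        fun p r => C (K.particleComp b p) (K.particleComp b r)

/-- The regime-adaptive bound with Chernoff parameter `α`. -/
def raBound [Fintype Θ] (K : GMMPolicy Θ X d J) (b : ParticleBelief Θ X N) (α : ℝ) : ℝ :=
  K.raBoundWith b (fun g => diffEntropy g.pdf) (fun g g' => klDivergence g.pdf g'.pdf)
    fun g g' => chernoffDivergence α g.pdf g'.pdf

/-- The regime-adaptive bound as an explicit expression in the weights, means and
covariances. -/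
def raFormula [Fintype Θ] (K : GMMPolicy Θ X d J) (b : ParticleBelief Θ X N) (α : ℝ) : ℝ :=
  K.raBoundWith b Gaussian.entropyFormula Gaussian.klFormula (Gaussian.chernoffFormula α)

end GMMPolicy

end ParticleMI

end

open ParticleMI

namespace ParticleMI

open Filter Topology

/-! The proof has two independent halves: mixtures of Gaussians with one common isotropic covariance
`v • 1` already suffice for the approximation, and for such mixtures every quantity in the bound is
explicit.

Bounds. The marginal entropy is at most the pairwise KL expression, since log-sum-exp is convex and
its tangent is taken where the linear term integrates to zero (`neg_integral_mul_log_le_pairwise`).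
It is at most the Gaussian entropy by Gibbs' inequality against the Gaussian with the same mean and
covariance (`neg_integral_mul_log_le_maxEntropyBound`). Each conditional entropy is at least the
Chernoff expression, by nonnegativity of the relative entropy of component weights followed by
Jensen (`pairwise_le_neg_integral_mul_log`). Hence `I(k̂)` is at most the bound.

Approximation. Finitely many densities are approximated simultaneously in `L¹`, together with the
entropies of finitely many nonnegative combinations. The property `Approximable` is stable under
dominated `L¹` limits (`Approximable.of_tendsto`), because `|u log u| ≤ |v log v| + v` for `0 ≤ u ≤
v` turns a finite-entropy envelope into a dominating function. It climbs from Gaussian mixtures to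
Gaussian convolutions, to continuous densities of bounded support, to bounded densities of bounded
support, and finally, by truncation, to all densities whose combinations have finite entropy
(`approximable_of_isDensity`).

Uniformity in the state. Scheffé's lemma makes `x ↦ k(·|θ,x)` continuous into `L¹`, so compactness
gives a finite measurable net. The net contains the particle states, so passing to it does not alter
the marginal or conditional densities at all, and only finitely many densities remain to be
approximated. -/

theorem abs_mul_log_le_of_le {u v : ℝ} (hu : 0 ≤ u) (huv : u ≤ v) :
    |u * Real.log u| ≤ |v * Real.log v| + v := by
  rcases hu.eq_or_lt with rfl | hu0
  · simp only [zero_mul, abs_zero]; positivity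
  have hv0 : 0 < v := hu0.trans_le huv
  rcases le_or_gt 1 u with h1 | h1
  · have h2 : 0 ≤ Real.log u := Real.log_nonneg h1
    have h3 : Real.log u ≤ Real.log v := Real.log_le_log hu0 huv
    rw [abs_of_nonneg (by positivity), abs_of_nonneg (mul_nonneg hv0.le (h2.trans h3))]
    have := mul_le_mul huv h3 h2 hv0.le
    linarith
  -- For `u < 1`, split `-u log u = u log (v/u) - u log v`; the first term is at most `v - u` by
  -- `log t ≤ t - 1`.
  · have h2 : Real.log u < 0 := Real.log_neg hu0 h1
    rw [abs_of_nonpos (mul_nonpos_of_nonneg_of_nonpos hu h2.le)]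
    have h3 : Real.log (v / u) ≤ v / u - 1 := Real.log_le_sub_one_of_pos (by positivity)
    rw [Real.log_div hv0.ne' hu0.ne'] at h3
    have h4 : u * (Real.log v - Real.log u) ≤ v - u := by
      have := mul_le_mul_of_nonneg_left h3 hu
      rwa [mul_sub u (v / u), mul_div_cancel₀ _ hu0.ne', mul_one] at this
    have h5 : -(u * Real.log v) ≤ |v * Real.log v| := by
      rw [abs_mul, abs_of_pos hv0]
      have h6 : -Real.log v ≤ |Real.log v| := neg_le_abs _
      have h7 := abs_nonneg (Real.log v)
      nlinarith [mul_le_mul_of_nonneg_left h6 hu, mul_le_mul_of_nonneg_right huv h7]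
    linarith

/-! ### Entropy integrals: domination, convergence, Gibbs' inequality and pairwise bounds for
mixtures -/

section Abstract

variable {α : Type*} [MeasurableSpace α] {μ : Measure α}

theorem aestronglyMeasurable_mul_log {u : α → ℝ} (hu : AEStronglyMeasurable u μ) :
    AEStronglyMeasurable (fun y => u y * Real.log (u y)) μ :=
  Real.continuous_mul_log.comp_aestronglyMeasurable hu

theorem integrable_mul_log_of_le {u v : α → ℝ} (hu : AEStronglyMeasurable u μ)
    (hu0 : ∀ y, 0 ≤ u y) (huv : ∀ y, u y ≤ v y) (hv : Integrable v μ)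
    (hv' : Integrable (fun y => v y * Real.log (v y)) μ) :
    Integrable (fun y => u y * Real.log (u y)) μ :=
  (hv'.abs.add hv).mono' (aestronglyMeasurable_mul_log hu)
    (ae_of_all _ fun y => abs_mul_log_le_of_le (hu0 y) (huv y))

/-- Entropy is not `L¹`-continuous in general; the envelope `v` of finite entropy repairs this.
Every subsequence has a further subsequence converging almost everywhere, along which dominated
convergence applies with dominating function `|v log v| + v`. -/
theorem tendsto_integral_mul_log {u : ℕ → α → ℝ} {f v : α → ℝ}
    (hu : ∀ n, Integrable (u n) μ) (hf : Integrable f μ)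
    (hu0 : ∀ n y, 0 ≤ u n y) (huv : ∀ n y, u n y ≤ v y) (hv : Integrable v μ)
    (hv' : Integrable (fun y => v y * Real.log (v y)) μ)
    (hlim : Tendsto (fun n => ∫ y, |u n y - f y| ∂μ) atTop (𝓝 0)) :
    Tendsto (fun n => ∫ y, u n y * Real.log (u n y) ∂μ) atTop
      (𝓝 (∫ y, f y * Real.log (f y) ∂μ)) := by
  refine tendsto_of_subseq_tendsto fun ns hns => ?_
  have h1 : Tendsto (fun n => eLpNorm (u (ns n) - f) 1 μ) atTop (𝓝 0) := by
    have h2 := (ENNReal.tendsto_ofReal (hlim.comp hns))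
    rw [ENNReal.ofReal_zero] at h2
    refine h2.congr fun n => ?_
    rw [eLpNorm_one_eq_lintegral_enorm]
    exact ofReal_integral_norm_eq_lintegral_enorm ((hu (ns n)).sub hf)
  obtain ⟨ms, -, hms⟩ := (tendstoInMeasure_of_tendsto_eLpNorm one_ne_zero
    (fun n => (hu (ns n)).aestronglyMeasurable) hf.aestronglyMeasurable h1).exists_seq_tendsto_ae
  refine ⟨ms, tendsto_integral_of_dominated_convergence _
    (fun n => aestronglyMeasurable_mul_log (hu _).aestronglyMeasurable) (hv'.abs.add hv)
    (fun n => ae_of_all _ fun y => abs_mul_log_le_of_le (hu0 _ y) (huv _ y)) ?_⟩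
  filter_upwards [hms] with y hy
  exact (Real.continuous_mul_log.tendsto _).comp hy

/-- Gibbs' inequality. -/
theorem integral_mul_log_le_integral_mul_log {p g : α → ℝ} (hp : Integrable p μ)
    (hg : Integrable g μ) (hp0 : ∀ y, 0 ≤ p y) (hg0 : ∀ y, 0 < g y)
    (hpg : ∫ y, g y ∂μ ≤ ∫ y, p y ∂μ)
    (hpp : Integrable (fun y => p y * Real.log (p y)) μ)
    (hpl : Integrable (fun y => p y * Real.log (g y)) μ) :
    ∫ y, p y * Real.log (g y) ∂μ ≤ ∫ y, p y * Real.log (p y) ∂μ := by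
  have h : ∫ y, (p y * Real.log (g y) + (p y - g y)) ∂μ ≤ ∫ y, p y * Real.log (p y) ∂μ := by
    refine integral_mono (hpl.add (hp.sub hg)) hpp fun y => ?_
    rcases (hp0 y).eq_or_lt with h0 | h0
    · simp [← h0, (hg0 y).le]
    have h1 := Real.log_le_sub_one_of_pos (div_pos (hg0 y) h0)
    rw [Real.log_div (hg0 y).ne' h0.ne'] at h1
    have h2 := mul_le_mul_of_nonneg_left h1 h0.le
    rw [mul_sub (p y) (g y / p y), mul_div_cancel₀ _ h0.ne', mul_one] at h2
    simp only
    linarith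
  have e : ∫ y, (p y * Real.log (g y) + (p y - g y)) ∂μ =
      ∫ y, p y * Real.log (g y) ∂μ + (∫ y, p y ∂μ - ∫ y, g y ∂μ) := by
    have hs : Integrable (fun y => p y - g y) μ := hp.sub hg
    rw [integral_add hpl hs, integral_sub hp hg]
  linarith

variable {ι : Type*}

/-- Convexity of the log-sum-exp function, as a supporting hyperplane inequality. -/
theorem log_sum_exp_add_le (s : Finset ι) (w a l : ι → ℝ) (hw : ∀ i ∈ s, 0 ≤ w i)
    (hZ : 0 < ∑ i ∈ s, w i * Real.exp (a i)) :
    Real.log (∑ i ∈ s, w i * Real.exp (a i)) +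
      ∑ i ∈ s, w i * Real.exp (a i) / (∑ j ∈ s, w j * Real.exp (a j)) * (l i - a i) ≤
      Real.log (∑ i ∈ s, w i * Real.exp (l i)) := by
  set Z := ∑ i ∈ s, w i * Real.exp (a i) with hZdef
  have hsum : ∑ i ∈ s, w i * Real.exp (a i) / Z = 1 := by
    rw [← Finset.sum_div, ← hZdef, div_self hZ.ne']
  -- Jensen's inequality for `exp` under the softmax weights at `a`, which form the gradient of
  -- log-sum-exp there.
  have hj := strictConvexOn_exp.convexOn.map_sum_le (t := s)
    (w := fun i => w i * Real.exp (a i) / Z) (p := fun i => l i - a i)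
    (fun i hi => div_nonneg (mul_nonneg (hw i hi) (Real.exp_pos _).le) hZ.le) hsum
    (fun i _ => Set.mem_univ _)
  simp only [smul_eq_mul] at hj
  have e : ∑ i ∈ s, w i * Real.exp (a i) / Z * Real.exp (l i - a i) =
      (∑ i ∈ s, w i * Real.exp (l i)) / Z := by
    rw [Finset.sum_div]
    refine Finset.sum_congr rfl fun i _ => ?_
    rw [Real.exp_sub]; field_simp
  rw [e] at hj
  have hpos : 0 < (∑ i ∈ s, w i * Real.exp (l i)) / Z := (Real.exp_pos _).trans_le hj
  have h2 := (Real.le_log_iff_exp_le hpos).2 hj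
  have hn : 0 < ∑ i ∈ s, w i * Real.exp (l i) := by
    have := mul_pos hpos hZ
    rwa [div_mul_cancel₀ _ hZ.ne'] at this
  rw [Real.log_div hn.ne' hZ.ne'] at h2
  linarith

theorem sum_mul_pos (s : Finset ι) (w a : ι → ℝ) (hw : ∀ i ∈ s, 0 ≤ w i)
    (hw1 : ∑ i ∈ s, w i = 1) (ha : ∀ i, 0 < a i) : 0 < ∑ i ∈ s, w i * a i := by
  have h0 : ∃ i ∈ s, w i ≠ 0 := by
    by_contra! h
    rw [Finset.sum_eq_zero h] at hw1
    exact zero_ne_one hw1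
  obtain ⟨i, hi, hwi⟩ := h0
  exact Finset.sum_pos' (fun j hj => mul_nonneg (hw j hj) (ha j).le)
    ⟨i, hi, mul_pos (lt_of_le_of_ne (hw i hi) hwi.symm) (ha i)⟩

/-- The pairwise upper bound for the entropy of a mixture; `D i j` is the Kullback-Leibler
divergence of the components. -/
theorem neg_integral_mul_log_le_pairwise (s : Finset ι) (w h : ι → ℝ) (D : ι → ι → ℝ)
    (g : ι → α → ℝ) (hw : ∀ i ∈ s, 0 ≤ w i) (hw1 : ∑ i ∈ s, w i = 1)
    (hg0 : ∀ i y, 0 < g i y) (hg : ∀ i, Integrable (g i) μ) (hg1 : ∀ i, ∫ y, g i y ∂μ = 1)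
    (hgl : ∀ i j, Integrable (fun y => g i y * Real.log (g j y)) μ)
    (hD : ∀ i j, ∫ y, g i y * Real.log (g j y) ∂μ = -h i - D i j)
    (hp : Integrable (fun y => (∑ i ∈ s, w i * g i y) * Real.log (∑ i ∈ s, w i * g i y)) μ) :
    -∫ y, (∑ i ∈ s, w i * g i y) * Real.log (∑ i ∈ s, w i * g i y) ∂μ ≤
      ∑ i ∈ s, w i * h i - ∑ i ∈ s, w i * Real.log (∑ j ∈ s, w j * Real.exp (-(D i j))) := by
  -- The tangent point `a i j` is the mean of `log g j` under `g i`, so the linear term of the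
  -- supporting hyperplane integrates to zero and only `log (Z i)` survives.
  set a : ι → ι → ℝ := fun i j => -h i - D i j with ha
  set Z : ι → ℝ := fun i => ∑ j ∈ s, w j * Real.exp (a i j) with hZ
  have hZ0 : ∀ i, 0 < Z i := fun i => sum_mul_pos s w _ hw hw1 fun _ => Real.exp_pos _
  set L : ι → ι → ℝ := fun i j => w j * Real.exp (a i j) / Z i with hL
  have hint : ∀ i j, Integrable (fun y => L i j * (g i y * Real.log (g j y) - a i j * g i y)) μ :=
    fun i j => ((hgl i j).sub ((hg i).const_mul _)).const_mul _
  have hsum : ∀ i, Integrable (fun y => ∑ j ∈ s,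
      L i j * (g i y * Real.log (g j y) - a i j * g i y)) μ :=
    fun i => integrable_finsetSum _ fun j _ => hint i j
  have hint2 : ∀ i, Integrable (fun y => w i * (Real.log (Z i) * g i y + ∑ j ∈ s,
      L i j * (g i y * Real.log (g j y) - a i j * g i y))) μ :=
    fun i => (((hg i).const_mul _).add (hsum i)).const_mul _
  have hle : ∫ y, ∑ i ∈ s, w i * (Real.log (Z i) * g i y + ∑ j ∈ s,
      L i j * (g i y * Real.log (g j y) - a i j * g i y)) ∂μ ≤
      ∫ y, (∑ i ∈ s, w i * g i y) * Real.log (∑ i ∈ s, w i * g i y) ∂μ := by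
    refine integral_mono (integrable_finsetSum _ fun i _ => hint2 i) hp fun y => ?_
    simp only
    rw [Finset.sum_mul]
    refine Finset.sum_le_sum fun i hi => ?_
    rw [mul_assoc]
    refine mul_le_mul_of_nonneg_left ?_ (hw i hi)
    have key := log_sum_exp_add_le s w (a i) (fun j => Real.log (g j y)) hw (hZ0 i)
    simp only [Real.exp_log (hg0 _ y)] at key
    have := mul_le_mul_of_nonneg_left key (hg0 i y).le
    refine le_trans (le_of_eq ?_) this
    rw [mul_add, mul_comm (g i y), Finset.mul_sum]
    congr 1
    refine Finset.sum_congr rfl fun j _ => ?_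
    simp only [hL, hZ]; ring
  have heq : ∫ y, ∑ i ∈ s, w i * (Real.log (Z i) * g i y + ∑ j ∈ s,
      L i j * (g i y * Real.log (g j y) - a i j * g i y)) ∂μ = ∑ i ∈ s, w i * Real.log (Z i) := by
    rw [integral_finsetSum _ fun i _ => hint2 i]
    refine Finset.sum_congr rfl fun i _ => ?_
    rw [integral_const_mul, integral_add ((hg i).const_mul _) (hsum i), integral_const_mul, hg1,
      integral_finsetSum _ fun j _ => hint i j, Finset.sum_eq_zero, mul_one, add_zero]
    intro j _
    rw [integral_const_mul, integral_sub (hgl i j) ((hg i).const_mul _), integral_const_mul, hg1,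
      hD, mul_one, sub_self, mul_zero]
  have hlog : ∀ i, Real.log (Z i) = -h i + Real.log (∑ j ∈ s, w j * Real.exp (-(D i j))) := by
    intro i
    have h1 : Z i = Real.exp (-h i) * ∑ j ∈ s, w j * Real.exp (-(D i j)) := by
      rw [Finset.mul_sum]
      refine Finset.sum_congr rfl fun j _ => ?_
      simp only [ha, sub_eq_add_neg, Real.exp_add]; ring
    rw [h1, Real.log_mul (Real.exp_pos _).ne'
      (sum_mul_pos s w _ hw hw1 fun _ => Real.exp_pos _).ne', Real.log_exp]
  rw [heq] at hle
  simp only [hlog, mul_add, Finset.sum_add_distrib, mul_neg, Finset.sum_neg_distrib] at hle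
  linarith

/-- The pointwise inequality behind the Chernoff lower bound. -/
theorem mixture_mul_log_le (s : Finset ι) (w : ι → ℝ) (β : ℝ) (x : ι → ℝ)
    (hw : ∀ i ∈ s, 0 ≤ w i) (hw1 : ∑ i ∈ s, w i = 1) (hx : ∀ i, 0 < x i) :
    (∑ i ∈ s, w i * x i) * Real.log (∑ i ∈ s, w i * x i) ≤
      ∑ i ∈ s, w i * x i * (Real.log (x i) + Real.log ((∑ j ∈ s, w j * x j ^ β) / x i ^ β)) := by
  set p := ∑ i ∈ s, w i * x i with hpdef
  have hp : 0 < p := sum_mul_pos s w x hw hw1 hx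
  set A := ∑ j ∈ s, w j * x j ^ β with hA
  have hA0 : 0 < A := sum_mul_pos s w _ hw hw1 fun i => Real.rpow_pos_of_pos (hx i) β
  -- Summed over `i` this is the nonnegativity of the relative entropy of the weights `w i * x i /
  -- p` with respect to `w i * x i ^ β / A`; the right-hand sides cancel.
  have key : ∀ i ∈ s, w i * x i * (Real.log p - Real.log (x i) - Real.log (A / x i ^ β)) ≤
      p / A * (w i * x i ^ β) - w i * x i := by
    intro i hi
    have hxb := Real.rpow_pos_of_pos (hx i) β
    have h1 := Real.log_le_sub_one_of_pos (x := p / (x i * (A / x i ^ β))) (by have := hx i; positivity)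
    rw [Real.log_div hp.ne' (by have := hx i; positivity),
      Real.log_mul (hx i).ne' (by positivity)] at h1
    have h2 := mul_le_mul_of_nonneg_left h1 (mul_nonneg (hw i hi) (hx i).le)
    have h3 : w i * x i * (p / (x i * (A / x i ^ β)) - 1) =
      p / A * (w i * x i ^ β) - w i * x i := by
      have := (hx i).ne'
      field_simp
    rw [h3] at h2
    refine le_trans (le_of_eq ?_) h2
    ring
  have h := Finset.sum_le_sum key
  rw [Finset.sum_sub_distrib, ← Finset.mul_sum, ← hA, div_mul_cancel₀ _ hA0.ne', ← hpdef,
    sub_self] at h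
  have e : ∑ i ∈ s, w i * x i * (Real.log p - Real.log (x i) - Real.log (A / x i ^ β)) =
    p * Real.log p - ∑ i ∈ s, w i * x i * (Real.log (x i) + Real.log (A / x i ^ β)) := by
    rw [hpdef, Finset.sum_mul, ← Finset.sum_sub_distrib]
    refine Finset.sum_congr rfl fun i _ => by ring
  linarith

/-- The pairwise lower bound for the entropy of a mixture; `D i j` is the Chernoff
`α`-divergence of the components. -/
theorem pairwise_le_neg_integral_mul_log (s : Finset ι) (w h : ι → ℝ) (D : ι → ι → ℝ) (t : ℝ)
    (g : ι → α → ℝ) (hw : ∀ i ∈ s, 0 ≤ w i) (hw1 : ∑ i ∈ s, w i = 1)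
    (hg0 : ∀ i y, 0 < g i y) (hg : ∀ i, Integrable (g i) μ) (hg1 : ∀ i, ∫ y, g i y ∂μ = 1)
    (hgl : ∀ i, Integrable (fun y => g i y * Real.log (g i y)) μ)
    (hh : ∀ i, ∫ y, g i y * Real.log (g i y) ∂μ = -h i)
    (hgD : ∀ i j, Integrable (fun y => g i y ^ t * g j y ^ (1 - t)) μ)
    (hD : ∀ i j, ∫ y, g i y ^ t * g j y ^ (1 - t) ∂μ = Real.exp (-(D i j)))
    (hp : Integrable (fun y => (∑ i ∈ s, w i * g i y) * Real.log (∑ i ∈ s, w i * g i y)) μ) :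
    ∑ i ∈ s, w i * h i - ∑ i ∈ s, w i * Real.log (∑ j ∈ s, w j * Real.exp (-(D i j))) ≤
      -∫ y, (∑ i ∈ s, w i * g i y) * Real.log (∑ i ∈ s, w i * g i y) ∂μ := by
  set Z : ι → ℝ := fun i => ∑ j ∈ s, w j * Real.exp (-(D i j)) with hZ
  have hZ0 : ∀ i, 0 < Z i := fun i => sum_mul_pos s w _ hw hw1 fun _ => Real.exp_pos _
  have hsum : ∀ i, Integrable (fun y => ∑ j ∈ s, w j * (g i y ^ t * g j y ^ (1 - t))) μ :=
    fun i => integrable_finsetSum _ fun j _ => (hgD i j).const_mul _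
  have hint : ∀ i, Integrable (fun y => w i * (g i y * Real.log (g i y) +
      ((Z i)⁻¹ * ∑ j ∈ s, w j * (g i y ^ t * g j y ^ (1 - t)) +
        (Real.log (Z i) - 1) * g i y))) μ :=
    fun i => ((hgl i).add (((hsum i).const_mul _).add ((hg i).const_mul _))).const_mul _
  have hle : ∫ y, (∑ i ∈ s, w i * g i y) * Real.log (∑ i ∈ s, w i * g i y) ∂μ ≤
      ∫ y, ∑ i ∈ s, w i * (g i y * Real.log (g i y) +
      ((Z i)⁻¹ * ∑ j ∈ s, w j * (g i y ^ t * g j y ^ (1 - t)) +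
        (Real.log (Z i) - 1) * g i y)) ∂μ := by
    refine integral_mono hp (integrable_finsetSum _ fun i _ => hint i) fun y => ?_
    refine (mixture_mul_log_le s w (1 - t) (fun i => g i y) hw hw1 fun i => hg0 i y).trans ?_
    refine Finset.sum_le_sum fun i hi => ?_
    rw [mul_assoc]
    refine mul_le_mul_of_nonneg_left ?_ (hw i hi)
    rw [mul_add]
    refine add_le_add le_rfl ?_
    set B := (∑ j ∈ s, w j * g j y ^ (1 - t)) / g i y ^ (1 - t) with hB
    have hgi := hg0 i y
    have hB0 : 0 < B := div_pos (sum_mul_pos s w _ hw hw1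
      fun j => Real.rpow_pos_of_pos (hg0 j y) _) (Real.rpow_pos_of_pos hgi _)
    -- Jensen in tangent form: `log` is linearized at `Z i`, the mean of `B` under `g i`, since `g i
    -- * B` is the weighted sum of the Chernoff integrands.
    have h1 := Real.log_le_sub_one_of_pos (div_pos hB0 (hZ0 i))
    rw [Real.log_div hB0.ne' (hZ0 i).ne'] at h1
    have h2 := mul_le_mul_of_nonneg_left (show Real.log B ≤ B / Z i - 1 + Real.log (Z i) by linarith)
      hgi.le
    refine h2.trans (le_of_eq ?_)
    have h3 : g i y * B = ∑ j ∈ s, w j * (g i y ^ t * g j y ^ (1 - t)) := by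
      have h4 : g i y / g i y ^ (1 - t) = g i y ^ t := by
        rw [div_eq_iff (Real.rpow_pos_of_pos hgi _).ne', ← Real.rpow_add hgi]; simp
      rw [hB, mul_div_assoc', mul_comm, mul_div_assoc, h4, Finset.sum_mul]
      exact Finset.sum_congr rfl fun j _ => by ring
    rw [← h3]; field_simp; ring
  have heq : ∫ y, ∑ i ∈ s, w i * (g i y * Real.log (g i y) +
      ((Z i)⁻¹ * ∑ j ∈ s, w j * (g i y ^ t * g j y ^ (1 - t)) +
        (Real.log (Z i) - 1) * g i y)) ∂μ = ∑ i ∈ s, w i * (-h i + Real.log (Z i)) := by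
    rw [integral_finsetSum _ fun i _ => hint i]
    refine Finset.sum_congr rfl fun i _ => ?_
    have hi : Integrable (fun y => (Z i)⁻¹ * ∑ j ∈ s, w j * (g i y ^ t * g j y ^ (1 - t)) +
        (Real.log (Z i) - 1) * g i y) μ := ((hsum i).const_mul _).add ((hg i).const_mul _)
    rw [integral_const_mul, integral_add (hgl i) hi,
      integral_add ((hsum i).const_mul _) ((hg i).const_mul _), integral_const_mul,
      integral_const_mul, hh, hg1, integral_finsetSum _ fun j _ => (hgD i j).const_mul _]
    simp only [integral_const_mul, hD]
    rw [show ∑ j ∈ s, w j * Real.exp (-(D i j)) = Z i from rfl, inv_mul_cancel₀ (hZ0 i).ne']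
    ring
  rw [heq] at hle
  simp only [mul_add, Finset.sum_add_distrib, mul_neg, Finset.sum_neg_distrib] at hle
  linarith

end Abstract

end ParticleMI

/-! ### Isotropic Gaussians: normalization and second moments -/

namespace ParticleMI

open Filter Topology

open ProbabilityTheory in
/-- The second moments of a one-dimensional Gaussian about two points. -/
theorem integral_gaussianReal_sub_sq (m x : ℝ) (v : NNReal) :
    ∫ t, (t - x) * (t - x) ∂gaussianReal m v = v + (m - x) * (m - x) := by
  have h1 : Integrable (fun t : ℝ => t) (gaussianReal m v) :=
    (memLp_id_gaussianReal (1 : NNReal)).integrable (by simp)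
  have h2 : Integrable (fun t : ℝ => t ^ 2) (gaussianReal m v) :=
    (memLp_id_gaussianReal (2 : NNReal)).integrable_sq
  have hv := variance_fun_id_gaussianReal (μ := m) (v := v)
  have hm := integral_id_gaussianReal (μ := m) (v := v)
  rw [variance_eq_integral aemeasurable_id', hm] at hv
  have h3 : Integrable (fun t : ℝ => (t - m) ^ 2) (gaussianReal m v) := by
    have : (fun t : ℝ => (t - m) ^ 2) = fun t => t ^ 2 + (-2 * m * t + m ^ 2) := by
      ext t; ring
    rw [this]
    exact h2.add ((h1.const_mul _).add (integrable_const _))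
  have h4 : (fun t : ℝ => (t - x) * (t - x)) =
      fun t => (t - m) ^ 2 + (2 * (m - x) * t + (-2 * (m - x) * m + (m - x) ^ 2)) := by
    ext t; ring
  have h5 : Integrable (fun t : ℝ => 2 * (m - x) * t + (-2 * (m - x) * m + (m - x) ^ 2))
    (gaussianReal m v) := (h1.const_mul _).add (integrable_const _)
  rw [h4, integral_add h3 h5, hv, integral_add (h1.const_mul _) (integrable_const _),
    integral_const_mul, hm]
  simp
  ring

open ProbabilityTheory in
theorem integrable_gaussianReal_sub_mul_sub (m x z : ℝ) (v : NNReal) :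
    Integrable (fun t => (t - x) * (t - z)) (gaussianReal m v) := by
  have h1 : Integrable (fun t : ℝ => t) (gaussianReal m v) :=
    (memLp_id_gaussianReal (1 : NNReal)).integrable (by simp)
  have h2 : Integrable (fun t : ℝ => t ^ 2) (gaussianReal m v) :=
    (memLp_id_gaussianReal (2 : NNReal)).integrable_sq
  have : (fun t : ℝ => (t - x) * (t - z)) = fun t => t ^ 2 + (-(x + z) * t + x * z) := by
    ext t; ring
  rw [this]
  exact h2.add ((h1.const_mul _).add (integrable_const _))

open ProbabilityTheory in
theorem integral_gaussianReal_sub (m x : ℝ) (v : NNReal) :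
    ∫ t, (t - x) ∂gaussianReal m v = m - x := by
  have h1 : Integrable (fun t : ℝ => t) (gaussianReal m v) :=
    (memLp_id_gaussianReal (1 : NNReal)).integrable (by simp)
  rw [integral_sub h1 (integrable_const _), integral_id_gaussianReal]
  simp

/-- The Gaussian with mean `m` and covariance `v • 1`. -/
noncomputable def isoGaussian {d : ℕ} (m : E d) (v : ℝ) (hv : 0 < v) : Gaussian d :=
  ⟨m, v • 1, Matrix.PosDef.one.smul hv⟩

variable {d : ℕ} {v : ℝ}

theorem quad_smul_one (c : ℝ) (x : E d) : Gaussian.quad (c • 1) x = c * ‖x‖ ^ 2 := by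
  rw [Gaussian.quad, Matrix.smul_mulVec, Matrix.one_mulVec, dotProduct_smul, EuclideanSpace.norm_sq_eq]
  simp [dotProduct, sq]

theorem inv_smul_one (hv : 0 < v) :
    (v • (1 : Matrix (Fin d) (Fin d) ℝ))⁻¹ = v⁻¹ • 1 := by
  apply Matrix.inv_eq_right_inv
  rw [Matrix.smul_mul, Matrix.one_mul, smul_smul, mul_inv_cancel₀ hv.ne', one_smul]

/-- The normalizing constant of the density of an isotropic Gaussian. -/
noncomputable def isoConst (d : ℕ) (v : ℝ) : ℝ := (Real.sqrt (2 * Real.pi * v))⁻¹ ^ d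

theorem isoConst_pos (hv : 0 < v) : 0 < isoConst d v := by
  unfold isoConst; positivity

theorem isoGaussian_pdf (m : E d) (hv : 0 < v) (y : E d) :
    (isoGaussian m v hv).pdf y = isoConst d v * Real.exp (-‖y - m‖ ^ 2 / (2 * v)) := by
  simp only [Gaussian.pdf, isoGaussian, inv_smul_one hv, quad_smul_one, isoConst]
  rw [Matrix.det_smul, Matrix.det_one, Fintype.card_fin, mul_one, ← mul_pow,
    Real.sqrt_eq_rpow, ← Real.rpow_natCast, ← Real.rpow_mul (by positivity), mul_comm (d : ℝ),
    Real.rpow_mul (by positivity), Real.rpow_natCast, ← Real.sqrt_eq_rpow, inv_pow]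
  congr 2
  field_simp

theorem isoGaussian_pdf_pos (m : E d) (hv : 0 < v) (y : E d) : 0 < (isoGaussian m v hv).pdf y := by
  rw [isoGaussian_pdf]
  exact mul_pos (isoConst_pos hv) (Real.exp_pos _)

theorem continuous_isoGaussian_pdf (m : E d) (hv : 0 < v) :
    Continuous (isoGaussian m v hv).pdf := by
  simp only [funext (isoGaussian_pdf m hv)]
  fun_prop

open ProbabilityTheory in
-- An isotropic covariance makes the coordinates independent, which reduces all moments to
-- one-dimensional ones.
theorem isoGaussian_pdf_eq_prod (m : E d) (hv : 0 < v) (y : E d) :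
    (isoGaussian m v hv).pdf y = ∏ i, gaussianPDFReal (m i) v.toNNReal (y i) := by
  rw [isoGaussian_pdf]
  simp only [gaussianPDFReal, Real.coe_toNNReal v hv.le]
  rw [Finset.prod_mul_distrib, Finset.prod_const, Finset.card_univ, Fintype.card_fin,
    ← Real.exp_sum, isoConst, EuclideanSpace.norm_sq_eq, ← Finset.sum_div, Finset.sum_neg_distrib]
  simp

open ProbabilityTheory in
theorem integrable_isoGaussian_pdf_mul_prod (m : E d) (hv : 0 < v) (h : Fin d → ℝ → ℝ)
    (hh : ∀ i, Integrable (h i) (gaussianReal (m i) v.toNNReal)) :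
    Integrable (fun y => (isoGaussian m v hv).pdf y * ∏ i, h i (y i)) := by
  have hv' : v.toNNReal ≠ 0 := (Real.toNNReal_pos.2 hv).ne'
  have h1 : Integrable (fun y : Fin d → ℝ =>
      ∏ i, (gaussianPDFReal (m i) v.toNNReal (y i) * h i (y i))) := by
    refine Integrable.fintype_prod (f := fun i t => gaussianPDFReal (m i) v.toNNReal t * h i t)
      fun i => ?_
    have := hh i
    rw [gaussianReal_of_var_ne_zero _ hv', integrable_withDensity_iff_integrable_smul'
      (measurable_gaussianPDF _ _) (ae_of_all _ fun x => gaussianPDF_lt_top)] at this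
    simpa [toReal_gaussianPDF] using this
  have h2 := (EuclideanSpace.volume_preserving_symm_measurableEquiv_toLp (Fin d)).integrable_comp_emb
    (MeasurableEquiv.measurableEmbedding _) (g := fun y : Fin d → ℝ =>
      ∏ i, (gaussianPDFReal (m i) v.toNNReal (y i) * h i (y i)))
  refine (h2.2 h1).congr (ae_of_all _ fun y => ?_)
  simp only [isoGaussian_pdf_eq_prod, ← Finset.prod_mul_distrib]
  rfl

open ProbabilityTheory in
theorem integral_isoGaussian_pdf_mul_prod (m : E d) (hv : 0 < v) (h : Fin d → ℝ → ℝ) :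
    ∫ y, (isoGaussian m v hv).pdf y * ∏ i, h i (y i) =
      ∏ i, ∫ t, h i t ∂gaussianReal (m i) v.toNNReal := by
  have hv' : v.toNNReal ≠ 0 := (Real.toNNReal_pos.2 hv).ne'
  have h2 := (EuclideanSpace.volume_preserving_symm_measurableEquiv_toLp (Fin d)).integral_comp
    (MeasurableEquiv.measurableEmbedding _) (fun y : Fin d → ℝ =>
      ∏ i, (gaussianPDFReal (m i) v.toNNReal (y i) * h i (y i)))
  simp only [integral_gaussianReal_eq_integral_smul hv', smul_eq_mul]
  rw [← integral_fintype_prod_volume_eq_prod, ← h2]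
  congr 1
  ext y
  simp only [isoGaussian_pdf_eq_prod, ← Finset.prod_mul_distrib]
  rfl

theorem integral_isoGaussian_pdf (m : E d) (hv : 0 < v) :
    ∫ y, (isoGaussian m v hv).pdf y = 1 := by
  have := integral_isoGaussian_pdf_mul_prod m hv fun _ _ => 1
  simpa using this

theorem integrable_isoGaussian_pdf (m : E d) (hv : 0 < v) :
    Integrable (isoGaussian m v hv).pdf :=
  integrable_of_integral_eq_one (integral_isoGaussian_pdf m hv)

/-- Second-order monomials become products of one-variable functions, uniformly in the cases `a = b`
and `a ≠ b`, so that the product formula for Gaussian integrals applies. -/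
theorem prod_ite_mul_ite (a b : Fin d) (y x : E d) :
    ∏ i, ((if i = a then y i - x i else 1) * if i = b then y i - x i else 1) =
      (y a - x a) * (y b - x b) := by
  rw [Finset.prod_mul_distrib]; simp

theorem integrable_isoGaussian_pdf_mul_sub_mul_sub (m x : E d) (hv : 0 < v) (a b : Fin d) :
    Integrable fun y => (isoGaussian m v hv).pdf y * ((y a - x a) * (y b - x b)) := by
  have := integrable_isoGaussian_pdf_mul_prod m hv
    (fun i t => (if i = a then t - x i else 1) * if i = b then t - x i else 1) fun i => by
      have h1 := integrable_gaussianReal_sub_mul_sub (m i) (x i) (x i) v.toNNReal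
      have h2 : Integrable (fun t => t - x i) (ProbabilityTheory.gaussianReal (m i) v.toNNReal) :=
        (((ProbabilityTheory.memLp_id_gaussianReal (1 : NNReal)).integrable (by simp)).sub
          (integrable_const (x i)))
      split_ifs <;> simp [h1, h2]
  simpa only [prod_ite_mul_ite] using this

theorem integral_isoGaussian_pdf_mul_sub_mul_sub (m x : E d) (hv : 0 < v) (a b : Fin d) :
    ∫ y, (isoGaussian m v hv).pdf y * ((y a - x a) * (y b - x b)) =
      v * (1 : Matrix (Fin d) (Fin d) ℝ) a b + (m a - x a) * (m b - x b) := by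
  have := integral_isoGaussian_pdf_mul_prod m hv
    (fun i t => (if i = a then t - x i else 1) * if i = b then t - x i else 1)
  simp only [prod_ite_mul_ite] at this
  rw [this]
  rcases eq_or_ne a b with rfl | hab
  · rw [Finset.prod_eq_single a]
    · simp [integral_gaussianReal_sub_sq, hv.le]
    · intro i _ hi; simp [hi]
    · simp
  · rw [← prod_ite_mul_ite, Matrix.one_apply_ne hab, mul_zero, zero_add]
    refine Finset.prod_congr rfl fun i _ => ?_
    by_cases h1 : i = a
    · subst h1; simp [hab, integral_gaussianReal_sub]
    · by_cases h2 : i = b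
      · subst h2; simp [Ne.symm hab, integral_gaussianReal_sub]
      · simp [h1, h2]

theorem quad_sub_eq_sum (A : Matrix (Fin d) (Fin d) ℝ) (y x : E d) :
    Gaussian.quad A (y - x) = ∑ a, ∑ b, A a b * ((y a - x a) * (y b - x b)) := by
  simp only [Gaussian.quad, dotProduct, Matrix.mulVec, Finset.mul_sum, WithLp.ofLp_sub,
    Pi.sub_apply]
  exact Finset.sum_congr rfl fun a _ => Finset.sum_congr rfl fun b _ => by ring

theorem integrable_isoGaussian_pdf_mul_quad (A : Matrix (Fin d) (Fin d) ℝ) (m x : E d)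
    (hv : 0 < v) : Integrable fun y => (isoGaussian m v hv).pdf y * Gaussian.quad A (y - x) := by
  simp only [quad_sub_eq_sum, Finset.mul_sum, mul_left_comm _ (A _ _)]
  exact integrable_finsetSum _ fun a _ => integrable_finsetSum _ fun b _ =>
    (integrable_isoGaussian_pdf_mul_sub_mul_sub m x hv a b).const_mul _

theorem integral_isoGaussian_pdf_mul_quad (A : Matrix (Fin d) (Fin d) ℝ) (m x : E d)
    (hv : 0 < v) : ∫ y, (isoGaussian m v hv).pdf y * Gaussian.quad A (y - x) =
      ∑ a, ∑ b, A a b * ((v • (1 : Matrix (Fin d) (Fin d) ℝ)) a b +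
        Matrix.vecMulVec (m - x).ofLp (m - x).ofLp a b) := by
  have hi := fun a b => (integrable_isoGaussian_pdf_mul_sub_mul_sub m x hv a b).const_mul (A a b)
  simp only [quad_sub_eq_sum, Finset.mul_sum, mul_left_comm _ (A _ _)]
  rw [integral_finsetSum _ fun a _ => integrable_finsetSum _ fun b _ => hi a b]
  refine Finset.sum_congr rfl fun a _ => ?_
  rw [integral_finsetSum _ fun b _ => hi a b]
  refine Finset.sum_congr rfl fun b _ => ?_
  rw [integral_const_mul, integral_isoGaussian_pdf_mul_sub_mul_sub]
  simp [Matrix.vecMulVec_apply]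

end ParticleMI

/-! ### Closed forms for the entropy and divergences of isotropic Gaussians -/

namespace ParticleMI

open Filter Topology

variable {d : ℕ} {v : ℝ}

theorem isoGaussian_quad_cov (m : E d) (hv : 0 < v) (x : E d) :
    Gaussian.quad (isoGaussian m v hv).cov⁻¹ x = ‖x‖ ^ 2 / v := by
  rw [isoGaussian, inv_smul_one hv, quad_smul_one]
  ring

theorem log_isoConst (hv : 0 < v) :
    Real.log (isoConst d v) = -(d / 2 * Real.log (2 * Real.pi * v)) := by
  rw [isoConst, Real.log_pow, Real.log_inv, Real.log_sqrt (by positivity)]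
  ring

theorem log_isoGaussian_pdf (m : E d) (hv : 0 < v) (y : E d) :
    Real.log ((isoGaussian m v hv).pdf y) =
      Real.log (isoConst d v) - Gaussian.quad ((2 * v)⁻¹ • 1) (y - m) := by
  rw [isoGaussian_pdf, Real.log_mul (isoConst_pos hv).ne' (Real.exp_pos _).ne', Real.log_exp,
    quad_smul_one]
  ring

theorem integrable_isoGaussian_pdf_mul_log (m m' : E d) (hv : 0 < v) :
    Integrable fun y => (isoGaussian m v hv).pdf y * Real.log ((isoGaussian m' v hv).pdf y) := by
  simp only [log_isoGaussian_pdf, mul_sub]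
  exact ((integrable_isoGaussian_pdf m hv).mul_const _).sub
    (integrable_isoGaussian_pdf_mul_quad _ m m' hv)

theorem integral_isoGaussian_pdf_mul_log (m m' : E d) (hv : 0 < v) :
    ∫ y, (isoGaussian m v hv).pdf y * Real.log ((isoGaussian m' v hv).pdf y) =
      Real.log (isoConst d v) - d / 2 - ‖m' - m‖ ^ 2 / (2 * v) := by
  simp only [log_isoGaussian_pdf, mul_sub]
  rw [integral_sub ((integrable_isoGaussian_pdf m hv).mul_const _)
    (integrable_isoGaussian_pdf_mul_quad _ m m' hv), integral_mul_const,
    integral_isoGaussian_pdf, integral_isoGaussian_pdf_mul_quad]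
  simp only [Matrix.smul_apply, Matrix.one_apply, Matrix.vecMulVec_apply, smul_eq_mul, mul_ite,
    mul_one, mul_zero, ite_mul, zero_mul, Finset.sum_ite_eq, Finset.mem_univ, if_true, mul_add,
    Finset.sum_add_distrib, Finset.sum_const, Finset.card_univ, Fintype.card_fin, nsmul_eq_mul]
  rw [norm_sub_rev, EuclideanSpace.norm_sq_eq, Finset.sum_div]
  have : ∀ i, (2 * v)⁻¹ * ((m - m').ofLp i * (m - m').ofLp i) = ‖(m - m').ofLp i‖ ^ 2 / (2 * v) := by
    intro i
    rw [Real.norm_eq_abs, sq_abs]; ring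
  simp only [this]
  field_simp
  ring

theorem isoGaussian_entropyFormula (m : E d) (hv : 0 < v) :
    (isoGaussian m v hv).entropyFormula = -(Real.log (isoConst d v) - d / 2) := by
  rw [Gaussian.entropyFormula, isoGaussian, Matrix.det_smul, Matrix.det_one, Fintype.card_fin,
    mul_one, ← mul_pow, Real.log_pow, log_isoConst hv,
    show 2 * Real.pi * Real.exp 1 * v = 2 * Real.pi * v * Real.exp 1 by ring,
    Real.log_mul (by positivity) (Real.exp_pos _).ne', Real.log_exp]
  ring

theorem diffEntropy_isoGaussian (m : E d) (hv : 0 < v) :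
    diffEntropy (isoGaussian m v hv).pdf = (isoGaussian m v hv).entropyFormula := by
  rw [diffEntropy, integral_isoGaussian_pdf_mul_log, isoGaussian_entropyFormula]
  simp

theorem isoGaussian_klFormula (m m' : E d) (hv : 0 < v) :
    (isoGaussian m v hv).klFormula (isoGaussian m' v hv) = ‖m' - m‖ ^ 2 / (2 * v) := by
  rw [Gaussian.klFormula, isoGaussian_quad_cov]
  have h1 : ((isoGaussian m' v hv).cov⁻¹ * (isoGaussian m v hv).cov).trace = d := by
    rw [isoGaussian, isoGaussian, inv_smul_one hv, Matrix.smul_mul, Matrix.one_mul, smul_smul,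
      inv_mul_cancel₀ hv.ne', one_smul, Matrix.trace_one, Fintype.card_fin]
  have h2 : (isoGaussian m' v hv).cov.det / (isoGaussian m v hv).cov.det = 1 :=
    div_self (isoGaussian m v hv).posDef.det_pos.ne'
  rw [h1, h2, Real.log_one]
  simp only [isoGaussian]
  ring

theorem klDivergence_isoGaussian (m m' : E d) (hv : 0 < v) :
    klDivergence (isoGaussian m v hv).pdf (isoGaussian m' v hv).pdf =
      (isoGaussian m v hv).klFormula (isoGaussian m' v hv) := by
  have h : ∀ y, (isoGaussian m v hv).pdf y *
      Real.log ((isoGaussian m v hv).pdf y / (isoGaussian m' v hv).pdf y) =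
      (isoGaussian m v hv).pdf y * Real.log ((isoGaussian m v hv).pdf y) -
      (isoGaussian m v hv).pdf y * Real.log ((isoGaussian m' v hv).pdf y) := fun y => by
    rw [Real.log_div (isoGaussian_pdf_pos m hv y).ne' (isoGaussian_pdf_pos m' hv y).ne']; ring
  rw [klDivergence, isoGaussian_klFormula]
  simp only [h]
  rw [integral_sub (integrable_isoGaussian_pdf_mul_log _ _ _)
    (integrable_isoGaussian_pdf_mul_log _ _ _), integral_isoGaussian_pdf_mul_log,
    integral_isoGaussian_pdf_mul_log]
  simp

theorem isoGaussian_chernoffFormula (α : ℝ) (m m' : E d) (hv : 0 < v) :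
    (isoGaussian m v hv).chernoffFormula α (isoGaussian m' v hv) =
      α * (1 - α) * ‖m' - m‖ ^ 2 / (2 * v) := by
  have h1 : (1 - α) • (isoGaussian m v hv).cov + α • (isoGaussian m' v hv).cov =
      (isoGaussian m v hv).cov := by
    change (1 - α) • (isoGaussian m v hv).cov + α • (isoGaussian m v hv).cov = _
    rw [← add_smul]; simp
  have h2 : (isoGaussian m v hv).cov.det / ((isoGaussian m v hv).cov.det ^ (1 - α) *
      (isoGaussian m' v hv).cov.det ^ α) = 1 := by
    change (isoGaussian m v hv).cov.det / ((isoGaussian m v hv).cov.det ^ (1 - α) *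
      (isoGaussian m v hv).cov.det ^ α) = 1
    have := (isoGaussian m v hv).posDef.det_pos
    rw [← Real.rpow_add this]
    simp [this.ne']
  rw [Gaussian.chernoffFormula, h1, h2, isoGaussian_quad_cov, Real.log_one]
  simp only [isoGaussian]
  ring

/-- Completing the square: with a common covariance, the weighted geometric mean of two Gaussian
densities is again such a density, centred at the interpolated mean, up to a constant. That constant
is the Chernoff integral. -/
theorem isoGaussian_pdf_rpow_mul_rpow (α : ℝ) (m m' : E d) (hv : 0 < v) (y : E d) :
    (isoGaussian m v hv).pdf y ^ α * (isoGaussian m' v hv).pdf y ^ (1 - α) =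
      Real.exp (-(α * (1 - α) * ‖m' - m‖ ^ 2 / (2 * v))) *
        (isoGaussian (α • m + (1 - α) • m') v hv).pdf y := by
  have hc := isoConst_pos (d := d) hv
  simp only [isoGaussian_pdf]
  rw [Real.mul_rpow hc.le (Real.exp_pos _).le, Real.mul_rpow hc.le (Real.exp_pos _).le,
    ← Real.exp_mul, ← Real.exp_mul]
  have h1 : isoConst d v ^ α * isoConst d v ^ (1 - α) = isoConst d v := by
    rw [← Real.rpow_add hc]; simp
  have h2 : ‖y - (α • m + (1 - α) • m')‖ ^ 2 + α * (1 - α) * ‖m' - m‖ ^ 2 =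
      α * ‖y - m‖ ^ 2 + (1 - α) * ‖y - m'‖ ^ 2 := by
    simp only [← real_inner_self_eq_norm_sq, inner_sub_left, inner_sub_right, inner_add_left,
      inner_add_right, real_inner_smul_left, real_inner_smul_right]
    rw [real_inner_comm y m, real_inner_comm y m', real_inner_comm m m']
    ring
  have h3 : -‖y - m‖ ^ 2 / (2 * v) * α + -‖y - m'‖ ^ 2 / (2 * v) * (1 - α) =
      -(α * (1 - α) * ‖m' - m‖ ^ 2 / (2 * v)) +
        -‖y - (α • m + (1 - α) • m')‖ ^ 2 / (2 * v) := by
    field_simp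
    linarith
  rw [mul_mul_mul_comm, h1, ← Real.exp_add, h3, Real.exp_add]
  ring

theorem integrable_isoGaussian_pdf_rpow_mul_rpow (α : ℝ) (m m' : E d) (hv : 0 < v) :
    Integrable fun y =>
      (isoGaussian m v hv).pdf y ^ α * (isoGaussian m' v hv).pdf y ^ (1 - α) := by
  simp only [isoGaussian_pdf_rpow_mul_rpow]
  exact (integrable_isoGaussian_pdf _ hv).const_mul _

theorem integral_isoGaussian_pdf_rpow_mul_rpow (α : ℝ) (m m' : E d) (hv : 0 < v) :
    ∫ y, (isoGaussian m v hv).pdf y ^ α * (isoGaussian m' v hv).pdf y ^ (1 - α) =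
      Real.exp (-(isoGaussian m v hv).chernoffFormula α (isoGaussian m' v hv)) := by
  simp only [isoGaussian_pdf_rpow_mul_rpow]
  rw [integral_const_mul, integral_isoGaussian_pdf, mul_one, isoGaussian_chernoffFormula]

theorem chernoffDivergence_isoGaussian (α : ℝ) (m m' : E d) (hv : 0 < v) :
    chernoffDivergence α (isoGaussian m v hv).pdf (isoGaussian m' v hv).pdf =
      (isoGaussian m v hv).chernoffFormula α (isoGaussian m' v hv) := by
  rw [chernoffDivergence, integral_isoGaussian_pdf_rpow_mul_rpow, Real.log_exp, neg_neg]

/-! ### Exponential tails -/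

/-- The bound `(1 + r)^(d+2) ≤ (d+2)! * e^(1+r)` leaves decay of order `d + 1`, one more than the
dimension. This underlies the envelopes `C * exp (-‖y‖)`, which are integrable and have finite
entropy. -/
theorem integrable_one_add_norm_mul_exp_neg_norm :
    Integrable fun y : E d => (1 + ‖y‖) * Real.exp (-‖y‖) := by
  have h : Integrable fun y : E d => ((d + 2).factorial * Real.exp 1 : ℝ) *
      (1 + ‖y‖) ^ (-((d : ℝ) + 1)) :=
    (integrable_one_add_norm (by simp)).const_mul _
  refine h.mono' (by fun_prop) (ae_of_all _ fun y => ?_)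
  have h0 : 0 < 1 + ‖y‖ := by positivity
  rw [Real.norm_of_nonneg (by positivity)]
  have h1 := Real.pow_div_factorial_le_exp (1 + ‖y‖) h0.le (d + 2)
  have hf : (0 : ℝ) < (d + 2).factorial := by exact_mod_cast Nat.factorial_pos _
  rw [div_le_iff₀ hf, Real.exp_add] at h1
  rw [Real.rpow_neg h0.le, Real.exp_neg, ← div_eq_mul_inv, ← div_eq_mul_inv,
    show ((d : ℝ) + 1) = ((d + 1 : ℕ) : ℝ) by push_cast; ring, Real.rpow_natCast,
    div_le_div_iff₀ (Real.exp_pos _) (by positivity), ← pow_succ']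
  linarith

theorem integrable_const_mul_exp_neg_norm (C : ℝ) :
    Integrable fun y : E d => C * Real.exp (-‖y‖) := by
  refine Integrable.const_mul ?_ C
  refine integrable_one_add_norm_mul_exp_neg_norm.mono' (by fun_prop) (ae_of_all _ fun y => ?_)
  rw [Real.norm_of_nonneg (by positivity)]
  have := norm_nonneg y
  nlinarith [Real.exp_pos (-‖y‖)]

theorem integrable_exp_neg_norm_mul_log {C : ℝ} (hC : 0 < C) :
    Integrable fun y : E d => C * Real.exp (-‖y‖) * Real.log (C * Real.exp (-‖y‖)) := by
  simp only [Real.log_mul hC.ne' (Real.exp_pos _).ne', Real.log_exp]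
  have h := (integrable_one_add_norm_mul_exp_neg_norm (d := d)).const_mul C
  refine (((integrable_const_mul_exp_neg_norm (d := d) C).mul_const (Real.log C + 1)).sub h).congr
    (ae_of_all _ fun y => ?_)
  simp only [Pi.sub_apply]
  ring

theorem isoGaussian_pdf_le (m : E d) (hv : 0 < v) (y : E d) :
    (isoGaussian m v hv).pdf y ≤
      isoConst d v * Real.exp (v / 2 + ‖m‖) * Real.exp (-‖y‖) := by
  rw [isoGaussian_pdf, mul_assoc, ← Real.exp_add]
  refine mul_le_mul_of_nonneg_left (Real.exp_le_exp.2 ?_) (isoConst_pos hv).le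
  have h1 : ‖y‖ ≤ ‖y - m‖ + ‖m‖ := by simpa using norm_add_le (y - m) m
  -- The arithmetic-geometric mean inequality `r ≤ r² / (2v) + v / 2`.
  have h2 : -‖y - m‖ ^ 2 / (2 * v) ≤ v / 2 - ‖y - m‖ := by
    rw [div_le_iff₀ (by positivity)]
    nlinarith [sq_nonneg (‖y - m‖ - v)]
  linarith

theorem integrable_isoMixture_mul_log {ι : Type*} (s : Finset ι) (w : ι → ℝ) (m : ι → E d)
    (hv : 0 < v) (hw : ∀ i ∈ s, 0 ≤ w i) :
    Integrable fun y => (∑ i ∈ s, w i * (isoGaussian (m i) v hv).pdf y) *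
      Real.log (∑ i ∈ s, w i * (isoGaussian (m i) v hv).pdf y) := by
  set C := ∑ i ∈ s, w i * (isoConst d v * Real.exp (v / 2 + ‖m i‖)) + 1 with hC
  have hc := isoConst_pos (d := d) hv
  have hC0 : 0 < C := by
    have : 0 ≤ ∑ i ∈ s, w i * (isoConst d v * Real.exp (v / 2 + ‖m i‖)) :=
      Finset.sum_nonneg fun i hi => mul_nonneg (hw i hi) (by positivity)
    linarith
  refine integrable_mul_log_of_le (v := fun y => C * Real.exp (-‖y‖))
    (integrable_finsetSum _ fun i _ =>
      (integrable_isoGaussian_pdf (m i) hv).const_mul (w i)).aestronglyMeasurable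
    (fun y => Finset.sum_nonneg fun i hi => mul_nonneg (hw i hi) (isoGaussian_pdf_pos _ _ _).le)
    (fun y => ?_) (integrable_const_mul_exp_neg_norm C) (integrable_exp_neg_norm_mul_log hC0)
  rw [hC, add_mul, Finset.sum_mul]
  refine le_add_of_le_of_nonneg (Finset.sum_le_sum fun i hi => ?_) (by positivity)
  rw [mul_assoc]
  exact mul_le_mul_of_nonneg_left (isoGaussian_pdf_le _ _ _) (hw i hi)

/-! ### The maximum-entropy bound -/

theorem Gaussian.pdf_pos (g : Gaussian d) (y : E d) : 0 < g.pdf y := by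
  have := g.posDef.det_pos
  unfold Gaussian.pdf
  positivity

open scoped MatrixOrder in
-- Factor the inverse covariance as `Bᵀ B` and change variables by `B`. General covariances enter
-- because the global covariance of an isotropic mixture need not be isotropic; only normalization
-- is needed for them.
theorem Gaussian.exists_pdf_eq (g : Gaussian d) : ∃ B : Matrix (Fin d) (Fin d) ℝ, B.det ≠ 0 ∧
    ∀ y, g.pdf y = |B.det| * (isoGaussian 0 1 one_pos).pdf (Matrix.toEuclideanLin B (y - g.mean)) := by
  obtain ⟨B, hB⟩ := CStarAlgebra.nonneg_iff_eq_star_mul_self.mp g.posDef.inv.posSemidef.nonneg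
  have hdet : g.cov.det⁻¹ = B.det ^ 2 := by
    have := congrArg Matrix.det hB
    rw [Matrix.det_mul, Matrix.star_eq_conjTranspose, Matrix.det_conjTranspose,
      Matrix.det_nonsing_inv, Ring.inverse_eq_inv'] at this
    rw [this, sq]; rfl
  have hpos := g.posDef.det_pos
  refine ⟨B, fun h0 => ?_, fun y => ?_⟩
  · rw [h0] at hdet
    simp [hpos.ne'] at hdet
  have hq : ‖Matrix.toEuclideanLin B (y - g.mean)‖ ^ 2 = Gaussian.quad g.cov⁻¹ (y - g.mean) := by
    rw [hB, EuclideanSpace.real_norm_sq_eq, Gaussian.quad, ← Matrix.mulVec_mulVec,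
      Matrix.dotProduct_mulVec, Matrix.star_eq_conjTranspose, Matrix.vecMul_conjTranspose]
    simp [dotProduct, sq, Matrix.mulVec_sub]
  rw [isoGaussian_pdf, sub_zero, hq, Gaussian.pdf, ← mul_assoc]
  congr 1
  · rw [← Real.sqrt_sq_eq_abs, ← hdet, isoConst, mul_one, inv_pow,
      Real.sqrt_mul (by positivity), Real.sqrt_inv, mul_inv, mul_comm]
    congr 2
    rw [Real.sqrt_eq_rpow, Real.sqrt_eq_rpow, ← Real.rpow_natCast, ← Real.rpow_natCast,
      ← Real.rpow_mul (by positivity), ← Real.rpow_mul (by positivity), mul_comm (1 / 2 : ℝ)]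
  · ring_nf

theorem Gaussian.integral_pdf (g : Gaussian d) : ∫ y, g.pdf y = 1 := by
  obtain ⟨B, hB, h⟩ := g.exists_pdf_eq
  have hL : LinearMap.det (Matrix.toEuclideanLin B) = B.det := by simp
  have hc : Continuous (Matrix.toEuclideanLin B) := LinearMap.continuous_of_finiteDimensional _
  simp only [h]
  rw [integral_const_mul, integral_sub_right_eq_self
    (fun y => (isoGaussian 0 1 one_pos).pdf (Matrix.toEuclideanLin B y)) g.mean,
    ← integral_map hc.aemeasurable (continuous_isoGaussian_pdf _ _).aestronglyMeasurable,
    Measure.map_linearMap_addHaar_eq_smul_addHaar _ (by rwa [hL]), integral_smul_measure,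
    integral_isoGaussian_pdf, hL, ENNReal.toReal_ofReal (abs_nonneg _), abs_inv]
  simp [hB]

theorem posDef_mixtureCov_isoGaussian {ι : Type*} [Fintype ι] (w : ι → ℝ) (m : ι → E d)
    (hv : 0 < v) (hw : ∀ i, 0 ≤ w i) (hw1 : ∑ i, w i = 1) :
    (mixtureCov w fun i => isoGaussian (m i) v hv).PosDef := by
  simp only [mixtureCov, smul_add, Finset.sum_add_distrib, isoGaussian, ← Finset.sum_smul, hw1,
    one_smul]
  refine (Matrix.PosDef.one.smul hv).add_posSemidef (Matrix.posSemidef_sum _ fun i _ => ?_)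
  exact (Matrix.posSemidef_vecMulVec_self_star _).smul (hw i)

theorem neg_integral_mul_log_le_maxEntropyBound {ι : Type*} [Fintype ι] (w : ι → ℝ) (m : ι → E d)
    (hv : 0 < v) (hw : ∀ i, 0 ≤ w i) (hw1 : ∑ i, w i = 1) :
    -∫ y, (∑ i, w i * (isoGaussian (m i) v hv).pdf y) *
      Real.log (∑ i, w i * (isoGaussian (m i) v hv).pdf y) ≤
      maxEntropyBound w fun i => isoGaussian (m i) v hv := by
  set M : E d := ∑ i, w i • m i with hM
  set S := mixtureCov w (fun i => isoGaussian (m i) v hv) with hS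
  have hpd : S.PosDef := posDef_mixtureCov_isoGaussian w m hv hw hw1
  -- The comparison density in Gibbs' inequality. Its logarithm is quadratic, so its mean under the
  -- mixture depends only on the two moments that `G` shares with the mixture.
  set G : Gaussian d := ⟨M, S, hpd⟩ with hG
  have hdet : 0 < S.det := hpd.det_pos
  set c := (Real.sqrt ((2 * Real.pi) ^ d * S.det))⁻¹ with hc
  have hc0 : 0 < c := by positivity
  have hlog : ∀ y, Real.log (G.pdf y) = Real.log c - 1 / 2 * Gaussian.quad S⁻¹ (y - M) := by
    intro y
    rw [Gaussian.pdf, Real.log_mul hc0.ne' (Real.exp_pos _).ne', Real.log_exp]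
    ring
  have hi : ∀ i, Integrable fun y => w i * ((isoGaussian (m i) v hv).pdf y * Real.log (G.pdf y)) := by
    intro i
    simp only [hlog, mul_sub (Gaussian.pdf _ _), mul_left_comm (Gaussian.pdf _ _) (1 / 2)]
    exact (((integrable_isoGaussian_pdf _ hv).mul_const _).sub
      ((integrable_isoGaussian_pdf_mul_quad _ _ _ hv).const_mul _)).const_mul _
  have hpi : Integrable fun y => ∑ i, w i * (isoGaussian (m i) v hv).pdf y :=
    integrable_finsetSum _ fun i _ => (integrable_isoGaussian_pdf (m i) hv).const_mul (w i)
  have hp1 : ∫ y, ∑ i, w i * (isoGaussian (m i) v hv).pdf y = 1 := by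
    rw [integral_finsetSum _ fun i _ => (integrable_isoGaussian_pdf (m i) hv).const_mul (w i)]
    simp [integral_const_mul, integral_isoGaussian_pdf, hw1]
  have hgibbs := integral_mul_log_le_integral_mul_log hpi
    (integrable_of_integral_eq_one G.integral_pdf)
    (fun y => Finset.sum_nonneg fun i _ => mul_nonneg (hw i) (isoGaussian_pdf_pos _ _ _).le)
    G.pdf_pos (by rw [hp1, G.integral_pdf])
    (integrable_isoMixture_mul_log Finset.univ w m hv fun i _ => hw i)
    (by simp only [Finset.sum_mul, mul_assoc]; exact integrable_finsetSum _ fun i _ => hi i)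
  have hval : ∫ y, (∑ i, w i * (isoGaussian (m i) v hv).pdf y) * Real.log (G.pdf y) =
      Real.log c - d / 2 := by
    simp only [Finset.sum_mul, mul_assoc]
    rw [integral_finsetSum _ fun i _ => hi i]
    have h1 : ∀ i, ∫ y, w i * ((isoGaussian (m i) v hv).pdf y * Real.log (G.pdf y)) =
        w i * Real.log c - 1 / 2 * ∑ a, ∑ b, S⁻¹ a b *
          (w i • (v • (1 : Matrix (Fin d) (Fin d) ℝ) +
            Matrix.vecMulVec (m i - M).ofLp (m i - M).ofLp)) a b := by
      intro i
      rw [integral_const_mul]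
      simp only [hlog, mul_sub (Gaussian.pdf _ _), mul_left_comm (Gaussian.pdf _ _) (1 / 2)]
      rw [integral_sub ((integrable_isoGaussian_pdf _ hv).mul_const _)
        ((integrable_isoGaussian_pdf_mul_quad _ _ _ hv).const_mul _), integral_mul_const,
        integral_isoGaussian_pdf, integral_const_mul, integral_isoGaussian_pdf_mul_quad, mul_sub,
        one_mul, mul_left_comm, Finset.mul_sum]
      simp only [Finset.mul_sum, Matrix.smul_apply, Matrix.add_apply, smul_eq_mul]
      congr 1
      refine Finset.sum_congr rfl fun a _ => Finset.sum_congr rfl fun b _ => by ring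
    -- The entrywise sum is the trace of `S⁻¹ * Sᵀ`, so the symmetry of `S` is what makes it `d`.
    have h2 : ∑ a, ∑ b, S⁻¹ a b * S a b = (d : ℝ) := by
      have hsym : ∀ a b, S a b = S b a := fun a b => by
        simpa using congrFun (congrFun hpd.1 b) a
      have h3 : (S⁻¹ * S).trace = (d : ℝ) := by
        rw [Matrix.nonsing_inv_mul _ hdet.ne'.isUnit, Matrix.trace_one, Fintype.card_fin]
      rw [← h3, Matrix.trace]
      refine Finset.sum_congr rfl fun a _ => ?_
      rw [Matrix.diag_apply, Matrix.mul_apply]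
      exact Finset.sum_congr rfl fun b _ => by rw [hsym a b]
    have h3 : S = ∑ i, w i • (v • (1 : Matrix (Fin d) (Fin d) ℝ) +
            Matrix.vecMulVec (m i - M).ofLp (m i - M).ofLp) := rfl
    simp only [h1]
    rw [Finset.sum_sub_distrib, ← Finset.sum_mul, hw1, one_mul, ← Finset.mul_sum, Finset.sum_comm]
    congr 1
    have h4 : ∀ a, ∑ i, ∑ b, S⁻¹ a b * (w i • (v • (1 : Matrix (Fin d) (Fin d) ℝ) +
            Matrix.vecMulVec (m i - M).ofLp (m i - M).ofLp)) a b = ∑ b, S⁻¹ a b * S a b := by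
      intro a
      rw [Finset.sum_comm]
      refine Finset.sum_congr rfl fun b _ => ?_
      rw [← Finset.mul_sum]
      congr 1
      conv_rhs => rw [h3]
      rw [Matrix.sum_apply]
    simp only [h4, h2]
    ring
  have hlc : Real.log c = -(1 / 2 * Real.log ((2 * Real.pi) ^ d * S.det)) := by
    rw [hc, Real.log_inv, Real.log_sqrt (by positivity)]; ring
  have hmax : maxEntropyBound w (fun i => isoGaussian (m i) v hv) = -(Real.log c - d / 2) := by
    rw [maxEntropyBound, ← hS, hlc, mul_pow (2 * Real.pi), mul_right_comm,
      Real.log_mul (by positivity) (by positivity), Real.log_pow (Real.exp 1), Real.log_exp]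
    ring
  rw [hmax, ← hval]
  exact neg_le_neg hgibbs

end ParticleMI

/-! ### Simultaneous approximation of densities and entropies by Gaussian mixtures -/

namespace ParticleMI

open Filter Topology

variable {d : ℕ} {ι κ : Type*}

/-- A measurable probability density on `ℝ^d`. -/
structure IsDensity (f : E d → ℝ) : Prop where
  measurable : Measurable f
  nonneg : ∀ y, 0 ≤ f y
  integral_eq_one : ∫ y, f y = 1

theorem IsDensity.integrable {f : E d → ℝ} (h : IsDensity f) : Integrable f :=
  integrable_of_integral_eq_one h.integral_eq_one

/-- A family of mixtures of finitely many common Gaussians with a common covariance `v • 1`. -/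
def IsGaussFamily (g : ι → E d → ℝ) : Prop :=
  ∃ (J : ℕ) (m : Fin J → E d) (v : ℝ) (hv : 0 < v) (W : ι → Fin J → ℝ),
    (∀ i j, 0 ≤ W i j) ∧ (∀ i, ∑ j, W i j = 1) ∧
      ∀ i y, g i y = ∑ j, W i j * (isoGaussian (m j) v hv).pdf y

theorem IsGaussFamily.integrable {g : ι → E d → ℝ} (hg : IsGaussFamily g) (i : ι) :
    Integrable (g i) := by
  obtain ⟨J, m, v, hv, W, -, -, h⟩ := hg
  rw [funext (h i)]
  exact integrable_finsetSum _ fun j _ => (integrable_isoGaussian_pdf (m j) hv).const_mul _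

/-- The densities `f i` can be approximated in `L¹` by Gaussian mixtures, together with the
entropies of their combinations with coefficients `c k`. -/
def Approximable [Fintype ι] (c : κ → ι → ℝ) (f : ι → E d → ℝ) : Prop :=
  ∀ ε > 0, ∃ g : ι → E d → ℝ, IsGaussFamily g ∧ (∀ i, ∫ y, |f i y - g i y| ≤ ε) ∧
    ∀ k, |diffEntropy (fun y => ∑ i, c k i * f i y) - diffEntropy fun y => ∑ i, c k i * g i y| ≤ ε

theorem IsGaussFamily.approximable [Fintype ι] {g : ι → E d → ℝ} (hg : IsGaussFamily g)
    (c : κ → ι → ℝ) : Approximable c g := fun ε hε =>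
  ⟨g, hg, fun i => by simpa using hε.le, fun k => by simpa using hε.le⟩

theorem tendsto_integral_abs_sub {F : ℕ → E d → ℝ} {f b : E d → ℝ}
    (hF : ∀ n, AEStronglyMeasurable (F n)) (hf : Integrable f) (hb : Integrable b)
    (hle : ∀ n y, |F n y| ≤ b y) (hlim : ∀ᵐ y, Tendsto (fun n => F n y) atTop (𝓝 (f y))) :
    Tendsto (fun n => ∫ y, |F n y - f y|) atTop (𝓝 0) := by
  have := tendsto_integral_of_dominated_convergence (F := fun n y => |F n y - f y|)
    (f := fun _ => (0 : ℝ)) (fun y => b y + |f y|)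
    (fun n => ((hF n).sub hf.aestronglyMeasurable).norm) (hb.add hf.abs)
    (fun n => ae_of_all _ fun y => by
      rw [Real.norm_eq_abs, abs_abs]
      exact (abs_sub _ _).trans (add_le_add (hle n y) le_rfl)) (by
      filter_upwards [hlim] with y hy
      simpa using (hy.sub_const (f y)).abs)
  simpa using this

/-- The closure property that drives the approximation: convergence in `L¹` passes to the
combinations, and the envelopes `v k` let their entropies converge too. Finiteness of both index
types provides a single `n` for all requirements. -/
theorem Approximable.of_tendsto [Fintype ι] [Finite κ] {c : κ → ι → ℝ} {F : ℕ → ι → E d → ℝ}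
    {f : ι → E d → ℝ} (hF : ∀ n, Approximable c (F n)) (hc : ∀ k i, 0 ≤ c k i)
    (hFi : ∀ n i, Integrable (F n i)) (hfi : ∀ i, Integrable (f i)) (hF0 : ∀ n i y, 0 ≤ F n i y)
    (v : κ → E d → ℝ) (hv : ∀ k, Integrable (v k))
    (hv' : ∀ k, Integrable fun y => v k y * Real.log (v k y))
    (hle : ∀ n k y, ∑ i, c k i * F n i y ≤ v k y)
    (hlim : ∀ i, Tendsto (fun n => ∫ y, |F n i y - f i y|) atTop (𝓝 0)) :
    Approximable c f := by
  intro ε hε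
  have hcomb : ∀ k, Tendsto (fun n => ∫ y, |∑ i, c k i * F n i y - ∑ i, c k i * f i y|) atTop
      (𝓝 0) := by
    intro k
    have h1 : Tendsto (fun n => ∑ i, c k i * ∫ y, |F n i y - f i y|) atTop (𝓝 0) := by
      simpa using tendsto_finsetSum Finset.univ fun i _ => (hlim i).const_mul (c k i)
    refine squeeze_zero (fun n => integral_nonneg fun y => abs_nonneg _) (fun n => ?_) h1
    have hi : ∀ i, Integrable fun y => c k i * |F n i y - f i y| :=
      fun i => ((hFi n i).sub (hfi i)).abs.const_mul _
    simp only [← integral_const_mul]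
    rw [← integral_finsetSum _ fun i _ => hi i]
    refine integral_mono ?_ (integrable_finsetSum _ fun i _ => hi i) fun y => ?_
    · exact ((integrable_finsetSum _ fun i _ => (hFi n i).const_mul _).sub
        (integrable_finsetSum _ fun i _ => (hfi i).const_mul _)).abs
    · simp only [← Finset.sum_sub_distrib, ← mul_sub]
      refine (Finset.abs_sum_le_sum_abs _ _).trans (Finset.sum_le_sum fun i _ => ?_)
      rw [abs_mul, abs_of_nonneg (hc k i)]
  have hent : ∀ k, Tendsto (fun n => diffEntropy fun y => ∑ i, c k i * F n i y) atTop
      (𝓝 (diffEntropy fun y => ∑ i, c k i * f i y)) := fun k =>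
    (tendsto_integral_mul_log (u := fun n y => ∑ i, c k i * F n i y)
      (fun n => integrable_finsetSum _ fun i _ => (hFi n i).const_mul _)
      (integrable_finsetSum _ fun i _ => (hfi i).const_mul _)
      (fun n y => Finset.sum_nonneg fun i _ => mul_nonneg (hc k i) (hF0 n i y))
      (fun n y => hle n k y) (hv k) (hv' k) (hcomb k)).neg
  have h2 : ∀ᶠ n in atTop, ∀ i, ∫ y, |F n i y - f i y| < ε / 2 :=
    eventually_all.2 fun i => (hlim i).eventually_lt_const (half_pos hε)
  have h3 : ∀ᶠ n in atTop, ∀ k, dist (diffEntropy fun y => ∑ i, c k i * F n i y)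
      (diffEntropy fun y => ∑ i, c k i * f i y) < ε / 2 :=
    eventually_all.2 fun k => (Metric.tendsto_nhds.1 (hent k)) _ (half_pos hε)
  obtain ⟨n, hn2, hn3⟩ := (h2.and h3).exists
  obtain ⟨g, hg, hg1, hg2⟩ := hF n (ε / 2) (half_pos hε)
  refine ⟨g, hg, fun i => ?_, fun k => ?_⟩
  · have hi1 : Integrable fun y => |F n i y - f i y| := ((hFi n i).sub (hfi i)).abs
    have hi2 : Integrable fun y => |F n i y - g i y| := ((hFi n i).sub (hg.integrable i)).abs
    calc ∫ y, |f i y - g i y| ≤ ∫ y, (|F n i y - f i y| + |F n i y - g i y|) := by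
          refine integral_mono ((hfi i).sub (hg.integrable i)).abs (hi1.add hi2) fun y => ?_
          simp only
          rw [abs_sub_comm (F n i y) (f i y)]
          exact abs_sub_le _ _ _
      _ = (∫ y, |F n i y - f i y|) + ∫ y, |F n i y - g i y| := integral_add hi1 hi2
      _ ≤ ε := by linarith [hn2 i, hg1 i]
  · have h4 := hn3 k
    rw [dist_comm, Real.dist_eq] at h4
    exact (abs_sub_le _ _ _).trans (by linarith [hg2 k])

theorem Approximable.of_tendsto_of_le_exp [Fintype ι] [Finite κ] {c : κ → ι → ℝ}
    {F : ℕ → ι → E d → ℝ} {f : ι → E d → ℝ} (hF : ∀ n, Approximable c (F n))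
    (hc : ∀ k i, 0 ≤ c k i) (hFm : ∀ n i, AEStronglyMeasurable (F n i))
    (hF0 : ∀ n i y, 0 ≤ F n i y) (C : ℝ) (hle : ∀ n i y, F n i y ≤ C * Real.exp (-‖y‖))
    (hlim : ∀ i, ∀ᵐ y, Tendsto (fun n => F n i y) atTop (𝓝 (f i y))) :
    Approximable c f := by
  have hb := integrable_const_mul_exp_neg_norm (d := d) C
  have hFi : ∀ n i, Integrable (F n i) := fun n i =>
    hb.mono' (hFm n i) (ae_of_all _ fun y => by rw [Real.norm_of_nonneg (hF0 n i y)]; exact hle n i y)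
  have hfi : ∀ i, Integrable (f i) := fun i => by
    refine hb.mono' (aestronglyMeasurable_of_tendsto_ae atTop (fun n => hFm n i) (hlim i)) ?_
    filter_upwards [hlim i] with y hy
    rw [Real.norm_of_nonneg (ge_of_tendsto' hy fun n => hF0 n i y)]
    exact le_of_tendsto' hy fun n => hle n i y
  -- The `+ 1` keeps the envelope strictly positive even if all coefficients or `C` vanish, so that
  -- its logarithm splits.
  have hpos : ∀ k, 0 < (∑ i, c k i) * |C| + 1 := fun k => by
    have := mul_nonneg (Finset.sum_nonneg fun i (_ : i ∈ Finset.univ) => hc k i) (abs_nonneg C)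
    linarith
  refine Approximable.of_tendsto hF hc hFi hfi hF0
    (fun k y => ((∑ i, c k i) * |C| + 1) * Real.exp (-‖y‖))
    (fun k => integrable_const_mul_exp_neg_norm _)
    (fun k => integrable_exp_neg_norm_mul_log (hpos k)) (fun n k y => ?_)
    fun i => tendsto_integral_abs_sub (fun n => hFm n i) (hfi i) hb
      (fun n y => by rw [abs_of_nonneg (hF0 n i y)]; exact hle n i y) (hlim i)
  have he := Real.exp_pos (-‖y‖)
  calc ∑ i, c k i * F n i y ≤ ∑ i, c k i * (|C| * Real.exp (-‖y‖)) :=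
        Finset.sum_le_sum fun i _ => mul_le_mul_of_nonneg_left
          ((hle n i y).trans (mul_le_mul_of_nonneg_right (le_abs_self C) he.le)) (hc k i)
    _ = (∑ i, c k i) * |C| * Real.exp (-‖y‖) := by rw [← Finset.sum_mul]; ring
    _ ≤ _ := mul_le_mul_of_nonneg_right (by linarith) he.le

/-! ### Convolution with a Gaussian -/

theorem continuous_isoGaussian_pdf_mean {v : ℝ} (hv : 0 < v) (y : E d) :
    Continuous fun z : E d => (isoGaussian z v hv).pdf y := by
  simp only [isoGaussian_pdf]
  fun_prop

/-- A convolution is a continuous mixture. Rounding the centre `z` to the nearest of the first `n +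
1` points of a dense sequence gives a finite mixture: the weights are the masses of the cells under
`f i`, while the centres do not depend on `i`. -/
theorem approximable_gaussian_convolution [Fintype ι] [Finite κ] {c : κ → ι → ℝ}
    (hc : ∀ k i, 0 ≤ c k i) {f : ι → E d → ℝ} (hf : ∀ i, IsDensity (f i)) {R : ℝ}
    (hR : ∀ i z, R < ‖z‖ → f i z = 0) {v : ℝ} (hv : 0 < v) :
    Approximable c fun i y => ∫ z, f i z * (isoGaussian z v hv).pdf y := by
  set e : ℕ → E d := TopologicalSpace.denseSeq (E d) with he
  -- For `‖z‖ ≤ R` the rounded centre is no farther from `z` than `e 0` is, so its norm is at most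
  -- `R + (‖e 0‖ + R)`.
  set K := isoConst d v * Real.exp (v / 2 + (R + (‖e 0‖ + R))) with hK
  have hc0 := isoConst_pos (d := d) hv
  have hbound : ∀ n i z y, f i z * (isoGaussian (SimpleFunc.nearestPt e n z) v hv).pdf y ≤
      f i z * (K * Real.exp (-‖y‖)) := by
    intro n i z y
    rcases lt_or_ge R ‖z‖ with h | h
    · simp [hR i z h]
    · refine mul_le_mul_of_nonneg_left ((isoGaussian_pdf_le _ _ _).trans ?_) ((hf i).nonneg z)
      have h1 : dist (SimpleFunc.nearestPt e n z) z ≤ dist (e 0) z := by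
        have := SimpleFunc.edist_nearestPt_le e z (Nat.zero_le n)
        rwa [edist_dist, edist_dist, ENNReal.ofReal_le_ofReal_iff dist_nonneg] at this
      have h2 : ‖SimpleFunc.nearestPt e n z‖ ≤ R + (‖e 0‖ + R) := by
        have h3 := dist_triangle (SimpleFunc.nearestPt e n z) z 0
        have h4 := dist_triangle (e 0) 0 z
        rw [dist_zero_right, dist_zero_right] at h3
        rw [dist_zero_right, dist_zero_left] at h4
        linarith
      rw [hK]
      gcongr
  have hnonneg : ∀ n i z y, 0 ≤ f i z * (isoGaussian (SimpleFunc.nearestPt e n z) v hv).pdf y :=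
    fun n i z y => mul_nonneg ((hf i).nonneg z) (isoGaussian_pdf_pos _ _ _).le
  have hmeas : ∀ n i y, AEStronglyMeasurable
      fun z => f i z * (isoGaussian (SimpleFunc.nearestPt e n z) v hv).pdf y := fun n i y =>
    ((hf i).measurable.mul ((continuous_isoGaussian_pdf_mean hv y).measurable.comp
      (SimpleFunc.measurable _))).aestronglyMeasurable
  have hint : ∀ n i y, Integrable
      fun z => f i z * (isoGaussian (SimpleFunc.nearestPt e n z) v hv).pdf y := fun n i y =>
    ((hf i).integrable.mul_const (K * Real.exp (-‖y‖))).mono' (hmeas n i y)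
      (ae_of_all _ fun z => by rw [Real.norm_of_nonneg (hnonneg n i z y)]; exact hbound n i z y)
  have hfam : ∀ n, IsGaussFamily fun i y =>
      ∫ z, f i z * (isoGaussian (SimpleFunc.nearestPt e n z) v hv).pdf y := by
    intro n
    have hms : ∀ j : Fin (n + 1), MeasurableSet (SimpleFunc.nearestPtInd e n ⁻¹' {(j : ℕ)}) :=
      fun j => SimpleFunc.measurableSet_preimage _ _
    have hdis : Pairwise fun i j : Fin (n + 1) =>
        Disjoint (SimpleFunc.nearestPtInd e n ⁻¹' {(i : ℕ)})
          (SimpleFunc.nearestPtInd e n ⁻¹' {(j : ℕ)}) := fun i j hij =>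
      Disjoint.preimage _ (by simpa [Fin.val_inj] using hij)
    have huniv : (⋃ j : Fin (n + 1), SimpleFunc.nearestPtInd e n ⁻¹' {(j : ℕ)}) = Set.univ := by
      refine Set.eq_univ_of_forall fun z => Set.mem_iUnion.2
        ⟨⟨SimpleFunc.nearestPtInd e n z, Nat.lt_succ_of_le (SimpleFunc.nearestPtInd_le e n z)⟩, rfl⟩
    have hsplit : ∀ h : E d → ℝ, Integrable h → ∫ z, h z =
        ∑ j : Fin (n + 1), ∫ z in SimpleFunc.nearestPtInd e n ⁻¹' {(j : ℕ)}, h z := fun h hh => by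
      rw [← setIntegral_univ, ← huniv, integral_iUnion_fintype hms hdis fun j => hh.integrableOn]
    refine ⟨n + 1, fun j => e j, v, hv,
      fun i j => ∫ z in SimpleFunc.nearestPtInd e n ⁻¹' {(j : ℕ)}, f i z,
      fun i j => integral_nonneg (hf i).nonneg, fun i => ?_, fun i y => ?_⟩
    · rw [← hsplit _ (hf i).integrable, (hf i).integral_eq_one]
    · refine (hsplit _ (hint n i y)).trans ?_
      refine Finset.sum_congr rfl fun j _ => ?_
      rw [← integral_mul_const]
      refine setIntegral_congr_fun (hms j) fun z hz => ?_
      have : SimpleFunc.nearestPt e n z = e j := congrArg e hz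
      simp only [this]
  refine Approximable.of_tendsto_of_le_exp (fun n => (hfam n).approximable c) hc
    (fun n i => ((hfam n).integrable i).aestronglyMeasurable)
    (fun n i y => integral_nonneg fun z => hnonneg n i z y) K (fun n i y => ?_)
    fun i => ae_of_all _ fun y => ?_
  · refine (integral_mono (hint n i y) ((hf i).integrable.mul_const _)
      fun z => hbound n i z y).trans (le_of_eq ?_)
    rw [integral_mul_const, (hf i).integral_eq_one, one_mul]
  · refine tendsto_integral_of_dominated_convergence (fun z => f i z * (K * Real.exp (-‖y‖)))
      (fun n => hmeas n i y) ((hf i).integrable.mul_const _)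
      (fun n => ae_of_all _ fun z => by
        rw [Real.norm_of_nonneg (hnonneg n i z y)]; exact hbound n i z y)
      (ae_of_all _ fun z => ?_)
    refine Tendsto.const_mul _ (((continuous_isoGaussian_pdf_mean hv y).tendsto z).comp ?_)
    exact SimpleFunc.tendsto_nearestPt (by simp [he, (TopologicalSpace.denseRange_denseSeq (E d)).closure_range])

/-- The substitution `z = y - s • u` fixes the Gaussian and moves the scale into the argument of
`f`, where continuity handles `s → 0`. -/
theorem integral_mul_isoGaussian_pdf_eq (f : E d → ℝ) {s : ℝ} (hs : 0 < s) (y : E d) :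
    ∫ z, f z * (isoGaussian z (s ^ 2) (pow_pos hs 2)).pdf y =
      ∫ u, f (y - s • u) * (isoGaussian 0 1 one_pos).pdf u := by
  have h1 : ∀ u : E d, (isoGaussian 0 1 one_pos).pdf u =
      s ^ d * (isoGaussian (y - s • u) (s ^ 2) (pow_pos hs 2)).pdf y := by
    intro u
    rw [isoGaussian_pdf, isoGaussian_pdf, sub_sub_cancel, norm_smul, Real.norm_of_nonneg hs.le,
      sub_zero, ← mul_assoc]
    congr 1
    · rw [isoConst, isoConst, ← mul_pow, Real.sqrt_mul (by positivity) (s ^ 2),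
        Real.sqrt_sq hs.le, mul_one]
      congr 1
      field_simp
    · congr 1
      field_simp
  simp only [h1]
  rw [Measure.integral_comp_smul volume
    (fun u => f (y - u) * (s ^ d * (isoGaussian (y - u) (s ^ 2) (pow_pos hs 2)).pdf y)) s,
    integral_sub_left_eq_self (fun z => f z * (s ^ d * (isoGaussian z (s ^ 2) (pow_pos hs 2)).pdf y))
      volume y]
  simp only [mul_left_comm (f _)]
  rw [integral_const_mul, finrank_euclideanSpace_fin, smul_eq_mul, abs_of_pos (by positivity),
    ← mul_assoc, inv_mul_cancel₀ (by positivity), one_mul]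

theorem integrable_exp_norm_mul_isoGaussian_pdf :
    Integrable fun u : E d => Real.exp ‖u‖ * (isoGaussian 0 1 one_pos).pdf u := by
  have hc := isoConst_pos (d := d) one_pos
  refine (integrable_const_mul_exp_neg_norm (d := d) (isoConst d 1 * Real.exp 2)).mono'
    (((Real.continuous_exp.comp continuous_norm).mul
      (continuous_isoGaussian_pdf _ _)).aestronglyMeasurable) (ae_of_all _ fun u => ?_)
  rw [Real.norm_of_nonneg (mul_nonneg (Real.exp_pos _).le (isoGaussian_pdf_pos _ _ _).le),
    isoGaussian_pdf, sub_zero, mul_left_comm, mul_assoc, ← Real.exp_add, ← Real.exp_add]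
  refine mul_le_mul_of_nonneg_left (Real.exp_le_exp.2 ?_) hc.le
  nlinarith [sq_nonneg (‖u‖ - 2)]

theorem approximable_of_continuous [Fintype ι] [Finite κ] {c : κ → ι → ℝ}
    (hc : ∀ k i, 0 ≤ c k i) {f : ι → E d → ℝ} (hf : ∀ i, IsDensity (f i)) {R M : ℝ}
    (hR : ∀ i z, R < ‖z‖ → f i z = 0) (hM : ∀ i z, f i z ≤ M) (hcont : ∀ i, Continuous (f i)) :
    Approximable c f := by
  set s : ℕ → ℝ := fun n => 1 / ((n : ℝ) + 1) with hs
  have hs0 : ∀ n, 0 < s n := fun n => by simp only [hs]; positivity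
  have hs1 : ∀ n, s n ≤ 1 := fun n => by
    simp only [hs]; rw [div_le_one (by positivity)]; linarith [n.cast_nonneg (α := ℝ)]
  have hslim : Tendsto s atTop (𝓝 0) := tendsto_one_div_add_atTop_nhds_zero_nat
  have hexp := integrable_exp_norm_mul_isoGaussian_pdf (d := d)
  have hM' : ∀ i z, f i z ≤ |M| := fun i z => (hM i z).trans (le_abs_self M)
  have hg0 : ∀ u : E d, 0 < (isoGaussian 0 1 one_pos).pdf u := isoGaussian_pdf_pos _ _
  have hnonneg : ∀ n i y u, 0 ≤ f i (y - s n • u) * (isoGaussian 0 1 one_pos).pdf u :=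
    fun n i y u => mul_nonneg ((hf i).nonneg _) (hg0 u).le
  have hcts : ∀ n i, Continuous fun p : E d × E d =>
      f i (p.1 - s n • p.2) * (isoGaussian 0 1 one_pos).pdf p.2 := fun n i =>
    ((hcont i).comp (by fun_prop)).mul ((continuous_isoGaussian_pdf _ _).comp continuous_snd)
  have hcts' : ∀ n i y, Continuous fun u : E d =>
      f i (y - s n • u) * (isoGaussian 0 1 one_pos).pdf u := fun n i y =>
    (hcts n i).comp (Continuous.prodMk_right y)
  refine Approximable.of_tendsto_of_le_exp
    (F := fun n i y => ∫ u, f i (y - s n • u) * (isoGaussian 0 1 one_pos).pdf u)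
    (fun n => ?_) hc
    (fun n i => ((hcts n i).stronglyMeasurable.integral_prod_right').aestronglyMeasurable)
    (fun n i y => integral_nonneg fun u => hnonneg n i y u)
    (|M| * Real.exp R * ∫ u : E d, Real.exp ‖u‖ * (isoGaussian 0 1 one_pos).pdf u)
    (fun n i y => ?_) (fun i => ae_of_all _ fun y => ?_)
  · simp only [← integral_mul_isoGaussian_pdf_eq _ (hs0 n)]
    exact approximable_gaussian_convolution hc hf hR _
  · rw [mul_right_comm, ← integral_const_mul]
    refine integral_mono_of_nonneg (ae_of_all _ fun u => hnonneg n i y u) (hexp.const_mul _)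
      (ae_of_all _ fun u => ?_)
    simp only
    rw [← mul_assoc]
    refine mul_le_mul_of_nonneg_right ?_ (hg0 u).le
    -- Where `f i` can be nonzero, `‖y‖ ≤ R + ‖u‖` because `s n ≤ 1`; the loss `exp ‖u‖` is
    -- integrable against the Gaussian.
    rcases lt_or_ge R ‖y - s n • u‖ with h | h
    · rw [hR i _ h]; positivity
    · refine (hM' i _).trans ?_
      rw [mul_assoc, mul_assoc, ← Real.exp_add, ← Real.exp_add]
      refine le_mul_of_one_le_right (abs_nonneg M) (Real.one_le_exp ?_)
      have h1 : ‖y‖ ≤ ‖y - s n • u‖ + ‖s n • u‖ := by simpa using norm_add_le (y - s n • u) (s n • u)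
      have h2 : ‖s n • u‖ ≤ ‖u‖ := by
        rw [norm_smul, Real.norm_of_nonneg (hs0 n).le]
        exact mul_le_of_le_one_left (norm_nonneg u) (hs1 n)
      linarith
  · have hlim := tendsto_integral_of_dominated_convergence
      (F := fun n u => f i (y - s n • u) * (isoGaussian 0 1 one_pos).pdf u)
      (f := fun u => f i y * (isoGaussian 0 1 one_pos).pdf u)
      (fun u => |M| * (isoGaussian 0 1 one_pos).pdf u)
      (fun n => (hcts' n i y).aestronglyMeasurable)
      ((integrable_isoGaussian_pdf _ _).const_mul _)
      (fun n => ae_of_all _ fun u => by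
        rw [Real.norm_of_nonneg (hnonneg n i y u)]
        exact mul_le_mul_of_nonneg_right (hM' i _) (hg0 u).le)
      (ae_of_all _ fun u => ?_)
    · rwa [integral_const_mul, integral_isoGaussian_pdf, mul_one] at hlim
    · refine Tendsto.mul_const _ (((hcont i).tendsto y).comp ?_)
      simpa using (hslim.smul_const u).const_sub y

end ParticleMI

namespace ParticleMI

open Filter Topology

variable {d : ℕ} {ι κ : Type*}

/-! ### Mollification and truncation -/

open scoped Convolution in
-- Convolution with shrinking bumps preserves the bound and total mass, enlarges the support radius
-- by at most `1`, and converges almost everywhere by Lebesgue differentiation.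
theorem approximable_of_bounded [Fintype ι] [Finite κ] {c : κ → ι → ℝ}
    (hc : ∀ k i, 0 ≤ c k i) {f : ι → E d → ℝ} (hf : ∀ i, IsDensity (f i)) {R M : ℝ}
    (hR : ∀ i z, R < ‖z‖ → f i z = 0) (hM : ∀ i z, f i z ≤ M) : Approximable c f := by
  set r : ℕ → ℝ := fun n => 1 / ((n : ℝ) + 1) / 2 with hr
  have hr0 : ∀ n, 0 < r n := fun n => by simp only [hr]; positivity
  have hr1 : ∀ n, 2 * r n ≤ 1 := fun n => by
    simp only [hr]
    rw [mul_div_cancel₀ _ two_ne_zero, div_le_one (by positivity)]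
    linarith [n.cast_nonneg (α := ℝ)]
  have hrlim : Tendsto (fun n => 2 * r n) atTop (𝓝 0) := by
    simpa [hr, mul_div_cancel₀] using tendsto_one_div_add_atTop_nhds_zero_nat (𝕜 := ℝ)
  set φ : ℕ → ContDiffBump (0 : E d) := fun n => ⟨r n, 2 * r n, hr0 n, by linarith [hr0 n]⟩ with hφ
  set F : ℕ → ι → E d → ℝ := fun n i =>
    (φ n).normed volume ⋆[ContinuousLinearMap.lsmul ℝ ℝ, volume] f i with hFdef
  have hF : ∀ n i y, F n i y = ∫ t, (φ n).normed volume t * f i (y - t) := fun n i y => by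
    simp only [hFdef, convolution_lsmul, smul_eq_mul]
  have hcont : ∀ n i, Continuous (F n i) := fun n i =>
    (φ n).hasCompactSupport_normed.continuous_convolution_left _ (φ n).continuous_normed
      (hf i).integrable.locallyIntegrable
  have hM' : ∀ i z, f i z ≤ |M| := fun i z => (hM i z).trans (le_abs_self M)
  have hF0 : ∀ n i y, 0 ≤ F n i y := fun n i y => by
    rw [hF]
    exact integral_nonneg fun t => mul_nonneg ((φ n).nonneg_normed t) ((hf i).nonneg _)
  have hFM : ∀ n i y, F n i y ≤ |M| := fun n i y => by
    rw [hF]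
    refine (integral_mono_of_nonneg
      (ae_of_all _ fun t => mul_nonneg ((φ n).nonneg_normed t) ((hf i).nonneg _))
      ((φ n).integrable_normed.mul_const |M|)
      (ae_of_all _ fun t => mul_le_mul_of_nonneg_left (hM' i _) ((φ n).nonneg_normed t))).trans
      (le_of_eq ?_)
    rw [integral_mul_const, (φ n).integral_normed, one_mul]
  have hFR : ∀ n i y, R + 1 < ‖y‖ → F n i y = 0 := fun n i y hy => by
    rw [hF, integral_eq_zero_of_ae (ae_of_all _ fun t => ?_)]
    simp only [Pi.zero_apply]
    by_cases ht : (φ n).normed volume t = 0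
    · rw [ht, zero_mul]
    · have h1 : t ∈ Function.support ((φ n).normed volume) := ht
      rw [(φ n).support_normed_eq, mem_ball_zero_iff] at h1
      have h2 : ‖t‖ < 1 := h1.trans_le (hr1 n)
      have h3 : ‖y‖ ≤ ‖y - t‖ + ‖t‖ := by simpa using norm_add_le (y - t) t
      rw [hR i _ (by linarith), mul_zero]
  have hden : ∀ n i, IsDensity (F n i) := fun n i =>
    ⟨(hcont n i).measurable, hF0 n i, by
      rw [integral_convolution _ (φ n).integrable_normed (hf i).integrable, (φ n).integral_normed,
        (hf i).integral_eq_one]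
      simp⟩
  refine Approximable.of_tendsto_of_le_exp
    (fun n => approximable_of_continuous hc (hden n) (hFR n) (hFM n) (hcont n)) hc
    (fun n i => (hcont n i).aestronglyMeasurable) hF0 (|M| * Real.exp (R + 1)) (fun n i y => ?_)
    fun i => ContDiffBump.ae_convolution_tendsto_right_of_locallyIntegrable (K := 2) hrlim
      (Eventually.of_forall fun n => le_rfl) (hf i).integrable.locallyIntegrable
  rcases lt_or_ge (R + 1) ‖y‖ with h | h
  · rw [hFR n i y h]; positivity
  · rw [mul_assoc, ← Real.exp_add]
    exact (hFM n i y).trans (le_mul_of_one_le_right (abs_nonneg M) (Real.one_le_exp (by linarith)))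

/-- Cut each density off in space and in height, then renormalize. Once the remaining masses exceed
`1/2`, the result lies below `2 * f i`, so twice the given combination is an envelope, and it
inherits finite entropy from `hent`. -/
theorem approximable_of_isDensity [Fintype ι] [Finite κ] {c : κ → ι → ℝ}
    (hc : ∀ k i, 0 ≤ c k i) {f : ι → E d → ℝ} (hf : ∀ i, IsDensity (f i))
    (hent : ∀ k, HasFiniteEntropy fun y => ∑ i, c k i * f i y) : Approximable c f := by
  set A : ℕ → ι → Set (E d) := fun n i => {y | ‖y‖ ≤ n} ∩ {y | f i y ≤ n} with hA
  have hAm : ∀ n i, MeasurableSet (A n i) := fun n i =>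
    (measurableSet_le measurable_norm measurable_const).inter
      (measurableSet_le (hf i).measurable measurable_const)
  set T : ℕ → ι → E d → ℝ := fun n i => (A n i).indicator (f i) with hT
  have hTm : ∀ n i, Measurable (T n i) := fun n i => (hf i).measurable.indicator (hAm n i)
  have hT0 : ∀ n i y, 0 ≤ T n i y := fun n i y => Set.indicator_nonneg (fun y _ => (hf i).nonneg y) y
  have hTf : ∀ n i y, T n i y ≤ f i y := fun n i y =>
    Set.indicator_le_self' (fun y _ => (hf i).nonneg y) y
  have hTn : ∀ n i y, T n i y ≤ n := fun n i y =>
    Set.indicator_apply_le' (fun h => h.2) fun _ => n.cast_nonneg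
  have hTR : ∀ (n : ℕ) i y, (n : ℝ) < ‖y‖ → T n i y = 0 := fun n i y hy =>
    Set.indicator_of_notMem (fun h => absurd h.1 (not_le.2 hy)) _
  have hTlim : ∀ i y, Tendsto (fun n => T n i y) atTop (𝓝 (f i y)) := fun i y => by
    refine tendsto_const_nhds.congr' ?_
    filter_upwards [eventually_ge_atTop ⌈‖y‖⌉₊, eventually_ge_atTop ⌈f i y⌉₊] with n h1 h2
    exact (Set.indicator_of_mem (show y ∈ A n i from ⟨Nat.ceil_le.1 h1, Nat.ceil_le.1 h2⟩) _).symm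
  set μ : ℕ → ι → ℝ := fun n i => ∫ y, T n i y with hμ
  have hμlim : ∀ i, Tendsto (fun n => μ n i) atTop (𝓝 1) := fun i => by
    rw [← (hf i).integral_eq_one]
    exact tendsto_integral_of_dominated_convergence (f i) (fun n => (hTm n i).aestronglyMeasurable)
      (hf i).integrable (fun n => ae_of_all _ fun y => by
        rw [Real.norm_of_nonneg (hT0 n i y)]; exact hTf n i y) (ae_of_all _ (hTlim i))
  have hev : ∀ᶠ n in atTop, ∀ i, 1 / 2 < μ n i :=
    eventually_all.2 fun i => (hμlim i).eventually_const_lt (by norm_num)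
  obtain ⟨n₀, hn₀⟩ := eventually_atTop.1 hev
  have hμ2 : ∀ n i, 1 / 2 < μ (n + n₀) i := fun n i => hn₀ _ (Nat.le_add_left _ _) i
  have hμ0 : ∀ n i, 0 < μ (n + n₀) i := fun n i => lt_trans (by norm_num) (hμ2 n i)
  set F : ℕ → ι → E d → ℝ := fun n i y => T (n + n₀) i y / μ (n + n₀) i with hFdef
  have hF2 : ∀ n i y, F n i y ≤ 2 * T (n + n₀) i y := fun n i y => by
    simp only [hFdef]
    rw [div_le_iff₀ (hμ0 n i)]
    nlinarith [hT0 (n + n₀) i y, hμ2 n i]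
  have hF0 : ∀ n i y, 0 ≤ F n i y := fun n i y => div_nonneg (hT0 _ i y) (hμ0 n i).le
  have hFf : ∀ n i y, F n i y ≤ 2 * f i y := fun n i y =>
    (hF2 n i y).trans (by linarith [hTf (n + n₀) i y])
  have hden : ∀ n i, IsDensity (F n i) := fun n i =>
    ⟨(hTm _ i).div_const _, hF0 n i, by
      simp only [hFdef]
      rw [integral_div]
      exact div_self (hμ0 n i).ne'⟩
  have hsum : ∀ k, Integrable fun y => ∑ i, c k i * f i y := fun k =>
    integrable_finsetSum _ fun i _ => (hf i).integrable.const_mul _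
  refine Approximable.of_tendsto
    (fun n => approximable_of_bounded hc (hden n) (R := ((n + n₀ : ℕ) : ℝ))
      (M := 2 * ((n + n₀ : ℕ) : ℝ))
      (fun i z hz => by simp only [hFdef]; rw [hTR _ i z hz, zero_div])
      (fun i z => (hF2 n i z).trans (by linarith [hTn (n + n₀) i z]))) hc
    (fun n i => (hden n i).integrable) (fun i => (hf i).integrable) hF0
    (fun k y => 2 * ∑ i, c k i * f i y) (fun k => (hsum k).const_mul 2) (fun k => ?_)
    (fun n k y => ?_) (fun i => ?_)
  · refine (((hsum k).const_mul (2 * Real.log 2)).add ((hent k).const_mul 2)).congr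
      (ae_of_all _ fun y => ?_)
    simp only [Pi.add_apply]
    rcases eq_or_ne (∑ i, c k i * f i y) 0 with h | h
    · simp [h]
    · rw [Real.log_mul two_ne_zero h]; ring
  · rw [Finset.mul_sum]
    refine Finset.sum_le_sum fun i _ => ?_
    rw [mul_left_comm]
    exact mul_le_mul_of_nonneg_left (hFf n i y) (hc k i)
  · refine tendsto_integral_abs_sub (fun n => (hden n i).measurable.aestronglyMeasurable)
      (hf i).integrable ((hf i).integrable.const_mul 2)
      (fun n y => by rw [abs_of_nonneg (hF0 n i y)]; exact hFf n i y) (ae_of_all _ fun y => ?_)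
    have := ((hTlim i y).comp (tendsto_add_atTop_nat n₀)).div
      ((hμlim i).comp (tendsto_add_atTop_nat n₀)) one_ne_zero
    rwa [div_one] at this

/-! ### Continuity in the state and finite nets -/

/-- Scheffé's lemma. -/
theorem IsContinuousPolicy.tendsto_integral_abs_sub {Θ X : Type*} [TopologicalSpace X]
    [FirstCountableTopology X] {k : Θ → X → E d → ℝ} (hk : IsContinuousPolicy k) (t : Θ) (a : X) :
    Tendsto (fun x => ∫ y, |k t x y - k t a y|) (𝓝 a) (𝓝 0) := by
  have hint : ∀ x, Integrable (k t x) := fun x => integrable_of_integral_eq_one (hk.integral_eq_one t x)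
  -- Equal total masses reduce the distance to the positive part of `k t a - k t x`, which is
  -- dominated by the fixed density `k t a`.
  have h1 : ∀ x, ∫ y, |k t x y - k t a y| = 2 * ∫ y, max (k t a y - k t x y) 0 := by
    intro x
    have hpos : Integrable fun y => max (k t a y - k t x y) 0 := ((hint a).sub (hint x)).pos_part
    have h2 : ∀ y, |k t x y - k t a y| =
        2 * max (k t a y - k t x y) 0 - (k t a y - k t x y) := fun y => by
      rcases le_total (k t x y) (k t a y) with h | h
      · rw [abs_of_nonpos (by linarith), max_eq_left (by linarith)]; ring
      · rw [abs_of_nonneg (by linarith), max_eq_right (by linarith)]; ring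
    have hsub : Integrable fun y => k t a y - k t x y := (hint a).sub (hint x)
    simp only [h2]
    rw [integral_sub (hpos.const_mul 2) hsub, integral_const_mul,
      integral_sub (hint a) (hint x), hk.integral_eq_one, hk.integral_eq_one, sub_self, sub_zero]
  simp only [h1]
  have h3 : Tendsto (fun x => ∫ y, max (k t a y - k t x y) 0) (𝓝 a) (𝓝 (∫ _ : E d, (0 : ℝ))) := by
    refine tendsto_integral_filter_of_dominated_convergence (k t a)
      (Eventually.of_forall fun x =>
        (((hk.measurable t a).sub (hk.measurable t x)).max measurable_const).aestronglyMeasurable)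
      (Eventually.of_forall fun x => ae_of_all _ fun y => ?_) (hint a) (ae_of_all _ fun y => ?_)
    · rw [Real.norm_of_nonneg (le_max_right _ _)]
      exact max_le (by linarith [hk.nonneg t x y]) (hk.nonneg t a y)
    · have h4 : Tendsto (fun x => k t a y - k t x y) (𝓝 a) (𝓝 (k t a y - k t a y)) :=
        ((hk.continuous_state t y).tendsto a).const_sub _
      simpa using h4.max (tendsto_const_nhds (x := (0 : ℝ)))
  simpa using h3.const_mul 2

/-- A first-match rule along an enumeration of the finite set: each step adds one measurable case
distinction. -/
theorem exists_measurable_choice {X : Type*} [MeasurableSpace X] (U : X → Set X)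
    (hU : ∀ a, MeasurableSet (U a)) (A : Finset X) :
    ∃ s : X → X, Measurable s ∧ ∀ x ∈ ⋃ a ∈ A, U a, s x ∈ A ∧ x ∈ U (s x) := by
  classical
  induction A using Finset.induction_on with
  | empty => exact ⟨id, measurable_id, by simp⟩
  | insert a A _ ih =>
    obtain ⟨s, hs, hsA⟩ := ih
    refine ⟨fun x => if x ∈ U a then a else s x, Measurable.ite (hU a) measurable_const hs,
      fun x hx => ?_⟩
    by_cases hxa : x ∈ U a
    · simp [hxa]
    · have : x ∈ ⋃ b ∈ A, U b := by
        rw [Finset.set_biUnion_insert] at hx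
        exact hx.resolve_left hxa
      simp [hxa, hsA x this]

/-- A finite net of states, with a measurable assignment of states to points of the net that
fixes finitely many given states. -/
theorem IsContinuousPolicy.exists_measurable_net {Θ X : Type*} [TopologicalSpace X]
    [FirstCountableTopology X] [CompactSpace X] [T1Space X] [MeasurableSpace X] [BorelSpace X]
    {k : Θ → X → E d → ℝ} (hk : IsContinuousPolicy k) (t : Θ) (P : Finset X) {δ : ℝ} (hδ : 0 < δ) :
    ∃ (A : Finset X) (s : X → X), Measurable s ∧ (∀ x, s x ∈ A) ∧ (∀ x ∈ P, s x = x) ∧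
      ∀ x, ∫ y, |k t x y - k t (s x) y| ≤ δ := by
  classical
  set V : X → Set X := fun a => {x | ∫ y, |k t x y - k t a y| < δ} with hV
  have hVn : ∀ a, V a ∈ 𝓝 a := fun a =>
    (hk.tendsto_integral_abs_sub t a).eventually_lt_const hδ
  obtain ⟨B, hB⟩ := CompactSpace.elim_nhds_subcover (fun a => interior (V a))
    -- Interiors supply open, hence Borel, cells without requiring measurability of `V a` itself.
    fun a => interior_mem_nhds.2 (hVn a)
  obtain ⟨s, hs, hsB⟩ := exists_measurable_choice (fun a => interior (V a))
    (fun a => isOpen_interior.measurableSet) B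
  have hall : ∀ x, s x ∈ B ∧ x ∈ interior (V (s x)) := fun x => hsB x (by rw [hB]; trivial)
  -- Overriding the choice on the finite set `P` keeps it measurable, as finite sets are closed in a
  -- T1 space.
  refine ⟨P ∪ B, fun x => if x ∈ P then x else s x,
    Measurable.ite P.measurableSet measurable_id hs, fun x => ?_, fun x hx => by simp [hx],
    fun x => ?_⟩
  · by_cases hx : x ∈ P <;> simp [hx, (hall x).1]
  · by_cases hx : x ∈ P
    · simpa [hx] using hδ.le
    · simpa [hx] using (interior_subset (hall x).2 : x ∈ V (s x)).le

end ParticleMI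

namespace ParticleMI

open Filter Topology

/-! ### Particle beliefs -/

namespace ParticleBelief

variable {Θ X : Type*} {N : ℕ}

theorem mem_idx {b : ParticleBelief Θ X N} {t : Θ} {i : Fin N} : i ∈ b.idx t ↔ b.θ i = t := by
  simp [idx]

theorem q_nonneg (b : ParticleBelief Θ X N) (t : Θ) : 0 ≤ b.q t :=
  Finset.sum_nonneg fun i _ => b.ω_nonneg i

theorem sum_q [Fintype Θ] (b : ParticleBelief Θ X N) : ∑ t, b.q t = 1 := by
  classical
  rw [← b.ω_sum, ← Finset.sum_fiberwise Finset.univ b.θ b.ω]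
  refine Finset.sum_congr rfl fun t _ => Finset.sum_congr ?_ fun _ _ => rfl
  ext i
  simp [mem_idx]

theorem abs_mutualInfo_sub_le [Fintype Θ] {d : ℕ} (b : ParticleBelief Θ X N)
    {k k' : Θ → X → E d → ℝ} {ε : ℝ}
    (h : |diffEntropy (b.marginal k) - diffEntropy (b.marginal k')| ≤ ε)
    (h' : ∀ t, 0 < b.q t →
      |diffEntropy (b.conditional k t) - diffEntropy (b.conditional k' t)| ≤ ε) :
    |b.mutualInfo k - b.mutualInfo k'| ≤ ε + ε := by
  have h1 : |∑ t, b.q t * diffEntropy (b.conditional k t) -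
      ∑ t, b.q t * diffEntropy (b.conditional k' t)| ≤ ε := by
    rw [← Finset.sum_sub_distrib]
    calc _ ≤ ∑ t, |b.q t * diffEntropy (b.conditional k t) -
          b.q t * diffEntropy (b.conditional k' t)| := Finset.abs_sum_le_sum_abs _ _
      _ ≤ ∑ t, b.q t * ε := Finset.sum_le_sum fun t _ => by
          rw [← mul_sub, abs_mul, abs_of_nonneg (b.q_nonneg t)]
          rcases (b.q_nonneg t).eq_or_lt with h0 | h0
          · simp [← h0]
          · exact mul_le_mul_of_nonneg_left (h' t h0) h0.le
      _ = ε := by rw [← Finset.sum_mul, b.sum_q, one_mul]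
  rw [mutualInfo, mutualInfo, sub_sub_sub_comm]
  exact (abs_sub _ _).trans (add_le_add h h1)

end ParticleBelief

/-! ### The regime-adaptive bound for mixtures of Gaussians with a common covariance -/

namespace GMMPolicy

variable {Θ X : Type*} [MeasurableSpace X] {N d J : ℕ} {K : GMMPolicy Θ X d J}
  {m : Fin J → E d} {v : ℝ} {hv : 0 < v}

theorem particleWeight_nonneg (K : GMMPolicy Θ X d J) (b : ParticleBelief Θ X N)
    (p : Fin N × Fin J) : 0 ≤ K.particleWeight b p :=
  mul_nonneg (b.ω_nonneg _) (K.weight_nonneg _ _ _)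

theorem sum_particleWeight (K : GMMPolicy Θ X d J) (b : ParticleBelief Θ X N) :
    ∑ p, K.particleWeight b p = 1 := by
  simp only [particleWeight, Fintype.sum_prod_type, ← Finset.mul_sum, K.weight_sum, mul_one, b.ω_sum]

theorem condWeight_nonneg (K : GMMPolicy Θ X d J) (b : ParticleBelief Θ X N) (t : Θ)
    (p : Fin N × Fin J) : 0 ≤ K.condWeight b t p :=
  mul_nonneg (div_nonneg (b.ω_nonneg _) (b.q_nonneg t)) (K.weight_nonneg _ _ _)

theorem sum_condWeight (K : GMMPolicy Θ X d J) (b : ParticleBelief Θ X N) {t : Θ}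
    (ht : 0 < b.q t) : ∑ p ∈ b.idx t ×ˢ Finset.univ, K.condWeight b t p = 1 := by
  simp only [condWeight, Finset.sum_product, ← Finset.mul_sum, K.weight_sum, mul_one,
    ← Finset.sum_div]
  exact div_self ht.ne'

theorem marginal_density (K : GMMPolicy Θ X d J) (b : ParticleBelief Θ X N) (y : E d) :
    b.marginal K.density y = ∑ p, K.particleWeight b p * (K.particleComp b p).pdf y := by
  simp only [ParticleBelief.marginal, density, particleWeight, particleComp,
    Fintype.sum_prod_type, Finset.mul_sum, mul_assoc]

theorem conditional_density (K : GMMPolicy Θ X d J) (b : ParticleBelief Θ X N) (t : Θ) (y : E d) :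
    b.conditional K.density t y =
      ∑ p ∈ b.idx t ×ˢ Finset.univ, K.condWeight b t p * (K.particleComp b p).pdf y := by
  simp only [ParticleBelief.conditional, density, condWeight, particleComp,
    Finset.sum_product, Finset.mul_sum, mul_assoc]
  refine Finset.sum_congr rfl fun i hi => ?_
  rw [ParticleBelief.mem_idx.1 hi]

variable (hK : ∀ t x j, K.comp t x j = isoGaussian (m j) v hv) (b : ParticleBelief Θ X N)
include hK

theorem finiteEntropies_of_isoGaussian : b.FiniteEntropies K.density := by
  refine ⟨?_, fun t _ => ?_⟩
  · simp only [HasFiniteEntropy, marginal_density, particleComp, hK]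
    exact integrable_isoMixture_mul_log Finset.univ (K.particleWeight b) (fun p => m p.2) hv
      fun p _ => K.particleWeight_nonneg b p
  · simp only [HasFiniteEntropy, conditional_density, particleComp, hK]
    exact integrable_isoMixture_mul_log _ (K.condWeight b t) (fun p => m p.2) hv
      fun p _ => K.condWeight_nonneg b t p

theorem raBound_eq_raFormula_of_isoGaussian [Fintype Θ] (α : ℝ) :
    K.raBound b α = K.raFormula b α := by
  simp only [raBound, raFormula, raBoundWith, particleComp, hK, diffEntropy_isoGaussian,
    klDivergence_isoGaussian, chernoffDivergence_isoGaussian]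

/-- The two upper bounds apply to the marginal entropy, the Chernoff lower bound to the conditional
ones, which are subtracted with nonnegative weights. A parameter value of mass zero is treated
separately, since its weights do not sum to one. -/
theorem mutualInfo_le_raFormula_of_isoGaussian [Fintype Θ] (α : ℝ) :
    b.mutualInfo K.density ≤ K.raFormula b α := by
  have hfin := finiteEntropies_of_isoGaussian hK b
  rw [ParticleBelief.mutualInfo, raFormula, raBoundWith]
  refine sub_le_sub (le_min ?_ ?_) (Finset.sum_le_sum fun t _ => ?_)
  · have h := hfin.1
    simp only [HasFiniteEntropy, diffEntropy, marginal_density, particleComp, hK,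
      pairwiseEntropy] at h ⊢
    refine neg_integral_mul_log_le_pairwise (μ := volume) Finset.univ (K.particleWeight b) _ _
      (fun p => (isoGaussian (m p.2) v hv).pdf) (fun p _ => K.particleWeight_nonneg b p)
      (K.sum_particleWeight b) (fun p => isoGaussian_pdf_pos _ _)
      (fun p => integrable_isoGaussian_pdf _ _) (fun p => integral_isoGaussian_pdf _ _)
      (fun p r => integrable_isoGaussian_pdf_mul_log _ _ _) (fun p r => ?_) h
    rw [integral_isoGaussian_pdf_mul_log, isoGaussian_entropyFormula, isoGaussian_klFormula, neg_neg]
  · have hc : K.particleComp b = fun p => isoGaussian (m p.2) v hv := funext fun p => hK _ _ _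
    simp only [diffEntropy, marginal_density, hc]
    exact neg_integral_mul_log_le_maxEntropyBound _ _ hv (K.particleWeight_nonneg b)
      (K.sum_particleWeight b)
  · rcases (b.q_nonneg t).eq_or_lt with h0 | h0
    · simp [← h0]
    refine mul_le_mul_of_nonneg_left ?_ h0.le
    have h := hfin.2 t h0
    simp only [HasFiniteEntropy, diffEntropy, conditional_density, particleComp, hK,
      pairwiseEntropy] at h ⊢
    refine pairwise_le_neg_integral_mul_log (μ := volume) _ (K.condWeight b t) _ _ α
      (fun p => (isoGaussian (m p.2) v hv).pdf) (fun p _ => K.condWeight_nonneg b t p)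
      (K.sum_condWeight b h0) (fun p => isoGaussian_pdf_pos _ _)
      (fun p => integrable_isoGaussian_pdf _ _) (fun p => integral_isoGaussian_pdf _ _)
      (fun p => integrable_isoGaussian_pdf_mul_log _ _ _) (fun p => ?_)
      (fun p r => integrable_isoGaussian_pdf_rpow_mul_rpow _ _ _ _)
      (fun p r => integral_isoGaussian_pdf_rpow_mul_rpow _ _ _ _) h
    rw [integral_isoGaussian_pdf_mul_log, isoGaussian_entropyFormula, neg_neg, sub_self,
      norm_zero]
    simp

end GMMPolicy

/-! ### Approximation of policy kernels -/

/-- Approximation of a continuous policy by a Gaussian mixture policy whose components have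
constant means and a constant covariance `v • 1`. -/
theorem IsContinuousPolicy.exists_gmmPolicy {Θ X : Type*} [Fintype Θ] [TopologicalSpace X]
    [FirstCountableTopology X] [CompactSpace X] [T1Space X] [MeasurableSpace X] [BorelSpace X]
    {d N : ℕ} {k : Θ → X → E d → ℝ} (hk : IsContinuousPolicy k) (b : ParticleBelief Θ X N)
    (hH : b.FiniteEntropies k) {ε δ : ℝ} (hε : 0 < ε) (hδ : 0 < δ) :
    ∃ (J : ℕ) (m : Fin J → E d) (v : ℝ) (hv : 0 < v) (K : GMMPolicy Θ X d J),
      (∀ t x j, K.comp t x j = isoGaussian (m j) v hv) ∧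
      (∀ t x, ∫ y, |k t x y - K.density t x y| ≤ δ) ∧
      |b.mutualInfo k - b.mutualInfo K.density| ≤ ε := by
  classical
  -- Each net fixes all particle states, so replacing `x` by `s t x` leaves the particle densities,
  -- and hence their entropies, exactly unchanged.
  choose A s hs hsA hsP hsδ using fun t =>
    hk.exists_measurable_net t (Finset.univ.image b.x) (half_pos hδ)
  set B : Finset X := Finset.univ.biUnion A with hB
  have hsB : ∀ t x, s t x ∈ B := fun t x => Finset.mem_biUnion.2 ⟨t, Finset.mem_univ t, hsA t x⟩
  have hsx : ∀ t i, s t (b.x i) = b.x i := fun t i => hsP t _ (by simp)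
  set f : Θ × B → E d → ℝ := fun p => k p.1 p.2 with hf
  have hden : ∀ p, IsDensity (f p) := fun p =>
    ⟨hk.measurable _ _, hk.nonneg _ _, hk.integral_eq_one _ _⟩
  set sel : Θ → X → Θ × B := fun t x => (t, ⟨s t x, hsB t x⟩) with hsel
  -- The index `none` encodes the marginal and `some t` the conditional given `t`, so one
  -- approximation controls all entropies at once.
  set c : Option {t : Θ // 0 < b.q t} → Θ × B → ℝ := fun o p => o.elim
    (∑ i, b.ω i * if sel (b.θ i) (b.x i) = p then 1 else 0)
    (fun t => ∑ i ∈ b.idx t, b.ω i / b.q t * if sel t (b.x i) = p then 1 else 0) with hc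
  have hc0 : ∀ o p, 0 ≤ c o p := by
    rintro (_ | t) p
    · exact Finset.sum_nonneg fun i _ => mul_nonneg (b.ω_nonneg i) (by split_ifs <;> norm_num)
    · exact Finset.sum_nonneg fun i _ => mul_nonneg (div_nonneg (b.ω_nonneg i) (b.q_nonneg t))
        (by split_ifs <;> norm_num)
  have hnone : ∀ (F : Θ × B → E d → ℝ) y, ∑ p, c none p * F p y =
      ∑ i, b.ω i * F (sel (b.θ i) (b.x i)) y := fun F y => by
    simp only [hc, Option.elim, Finset.sum_mul]
    rw [Finset.sum_comm]
    simp
  have hsome : ∀ t (F : Θ × B → E d → ℝ) y, ∑ p, c (some t) p * F p y =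
      ∑ i ∈ b.idx t, b.ω i / b.q t * F (sel t (b.x i)) y := fun t F y => by
    simp only [hc, Option.elim, Finset.sum_mul]
    rw [Finset.sum_comm]
    simp
  have hmarg : (fun y => ∑ p, c none p * f p y) = b.marginal k := by
    ext y
    simp only [hnone, hf, hsel, hsx, ParticleBelief.marginal]
  have hcond : ∀ t, (fun y => ∑ p, c (some t) p * f p y) = b.conditional k t := by
    intro t
    ext y
    simp only [hsome, hf, hsel, hsx, ParticleBelief.conditional]
  have happ : Approximable c f := approximable_of_isDensity hc0 hden (by
    rintro (_ | t)
    · rw [hmarg]; exact hH.1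
    · rw [hcond]; exact hH.2 t t.2)
  -- Marginal and averaged conditional entropies cost `ε / 2` each; the other `δ / 2` is spent on
  -- the net.
  obtain ⟨g, hg, hg1, hg2⟩ := happ (min (ε / 2) (δ / 2)) (lt_min (half_pos hε) (half_pos hδ))
  have hgi := hg.integrable
  obtain ⟨J, m, v, hv, W, hW0, hW1, hgW⟩ := hg
  -- The weights depend on the state only through its net point, and any function on the finite set
  -- `B` is measurable.
  have hWm : ∀ t j, Measurable fun x => W (sel t x) j := fun t j =>
    (measurable_of_countable fun a : B => W (t, a) j).comp ((hs t).subtype_mk)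
  set K : GMMPolicy Θ X d J := ⟨fun t x => W (sel t x), fun _ _ j => isoGaussian (m j) v hv,
    fun t x => hW0 _, fun t x => hW1 _, hWm, fun t j => measurable_const,
    fun t j a c => measurable_const⟩ with hK
  have hKg : ∀ t x, K.density t x = g (sel t x) := fun t x =>
    funext fun y => (hgW (sel t x) y).symm
  refine ⟨J, m, v, hv, K, fun t x j => rfl, fun t x => ?_, ?_⟩
  · have hki : ∀ t x, Integrable (k t x) := fun t x =>
      integrable_of_integral_eq_one (hk.integral_eq_one t x)
    have h1 : Integrable fun y => |k t x y - k t (s t x) y| := ((hki _ _).sub (hki _ _)).abs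
    have h2 : Integrable fun y => |k t (s t x) y - g (sel t x) y| := ((hki _ _).sub (hgi _)).abs
    rw [hKg]
    calc _ ≤ ∫ y, (|k t x y - k t (s t x) y| + |k t (s t x) y - g (sel t x) y|) :=
          integral_mono ((hki _ _).sub (hgi _)).abs (h1.add h2) fun y => abs_sub_le _ _ _
      _ = (∫ y, |k t x y - k t (s t x) y|) + ∫ y, |k t (s t x) y - g (sel t x) y| :=
          integral_add h1 h2
      _ ≤ δ / 2 + δ / 2 := add_le_add (hsδ t x) ((hg1 (sel t x)).trans (min_le_right _ _))
      _ = δ := add_halves δ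
  · rw [← add_halves ε]
    refine b.abs_mutualInfo_sub_le ?_ fun t ht => ?_
    · have h := (hg2 none).trans (min_le_left _ _)
      rw [hmarg] at h
      simp only [hnone, ← hKg] at h
      exact h
    · have h := (hg2 (some ⟨t, ht⟩)).trans (min_le_left _ _)
      rw [hcond] at h
      simp only [hsome, ← hKg] at h
      exact h

end ParticleMI

/-! ### The main theorem -/

theorem mainTheorem9 {P n d N : ℕ} (S : Finset (E P)) (X : Set (E n)) (hX : IsCompact X)
    (b : ParticleBelief S X N) (k : S → X → E d → ℝ) (hk : IsContinuousPolicy k)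
    (hH : b.FiniteEntropies k) (ε δ : ℝ) (hε : 0 < ε) (hδ : 0 < δ) :
    ∃ (J : ℕ) (K : GMMPolicy S X d J),
      (∀ t x, ∫ y, |k t x y - K.density t x y| ≤ δ) ∧
      b.FiniteEntropies K.density ∧
      |b.mutualInfo k - b.mutualInfo K.density| ≤ ε ∧
      ∀ α ∈ Set.Icc (0 : ℝ) 1,
        b.mutualInfo k ≤ K.raBound b α + ε ∧ K.raBound b α = K.raFormula b α := by
  have := isCompact_iff_compactSpace.1 hX
  obtain ⟨J, m, v, hv, K, hK, hKδ, hKε⟩ := hk.exists_gmmPolicy b hH hε hδ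
  refine ⟨J, K, hKδ, GMMPolicy.finiteEntropies_of_isoGaussian hK b, hKε, fun α _ => ?_⟩
  have hform := GMMPolicy.raBound_eq_raFormula_of_isoGaussian hK b α
  have hle := GMMPolicy.mutualInfo_le_raFormula_of_isoGaussian hK b α
  refine ⟨?_, hform⟩
  rw [hform]
  linarith [(abs_le.1 hKε).2]
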